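/- **Setting.** Let $\bar{\mathcal X}$ be a measurable space of natural samples, $\mathcal P$ (all data) and $\mathcal P_l$ (labeled data, one labeled class) probability measures on it, and let $\mathcal T(\cdot\mid\bar x)$, $\bar x\in\bar{\mathcal X}$, be a Markov kernel to the set $\{1,\dots,N\}$ of augmented samples. Put $A^{(u)}_{xx'}=\mathbb E_{\bar x\sim\mathcal P}\,\mathcal T(x|\bar x)\mathcal T(x'|\bar x)$, $\mathfrak l_x=\mathbb E_{\bar x\sim\mathcal P_l}\mathcal T(x|\bar x)$ and $A(\delta)=\eta_uA^{(u)}+\delta\,\mathfrak l\mathfrak l^\top$, where the unlabeled graph is normalized to equal degrees: every row sum of $A(0)=\eta_uA^{(u)}$ is $1$. Let $D(\delta)$ be the diagonal matrix of row sums of $A(\delta)$ and $\dot A(\delta)=D(\delta)^{-1/2}A(\delta)D(\delta)^{-1/2}$, a symmetric positive semidefinite matrix for $\delta\ge0$. For a singular value decomposition $\dot A(\delta)=\sum_{j=1}^N\lambda_j(\delta)v_j(\delta)v_j(\delta)^\top$ with $\lambda_1(\delta)\ge\dots\ge\lambda_N(\delta)\ge0$ and orthonormal $v_j(\delta)$,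 let $V_k(\delta)=[v_1(\delta),\dots,v_k(\delta)]$, $\Sigma_k(\delta)=\mathrm{diag}(\lambda_1(\delta),\dots,\lambda_k(\delta))$, and let $Z(\delta)=D(\delta)^{-1/2}V_k(\delta)\Sigma_k(\delta)^{1/2}\in\mathbb R^{N\times k}$ be the spectral representation, whose rows are the features $z_1,\dots,z_N$. Quantities at $\delta=0$ carry the superscript $(u)$, with $Z=Z(0)$. Let $V_\varnothing^{(u)}\in\mathbb R^{N\times(N-k)}$ have as columns an orthonormal basis of the null space of $V_k^{(u)\top}$, $\tilde A^{(u)}_k=V_k^{(u)}\Sigma_k^{(u)}V_k^{(u)\top}$, and $\mathcal G_k=\lambda_k^{(u)}/\lambda_{k+1}^{(u)}\in[1,\infty]$ (with $\lambda_{N+1}^{(u)}=0$, and $1/\mathcal G_k=0$ if $\lambda^{(u)}_{k+1}=0<\lambda^{(u)}_k$). Let $\Pi$ be a partition of $\{1,\dots,N\}$ into nonempty classes. With the class means $\mu_\pi=\frac1{|\pi|}\sum_{i\in\pi}z_i$ and the overall mean $\mu_\Pi=\frac1N\sum_iz_i$, put $$\mathcal M_{intra}(\Pi,Z)=\sum_{\pi\in\Pi}\sum_{i\in\pi}\|z_i-\mu_\pi\|^2,\qquad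 \mathcal M_{inter}(\Pi,Z)=\sum_{\pi\in\Pi}|\pi|\,\|\mu_\pi-\mu_\Pi\|^2,\qquad \mathcal M_{kms}=\mathcal M_{intra}/\mathcal M_{inter},$$ and $\Delta_{kms}(\delta)=\mathcal M_{kms}(\Pi,Z)-\mathcal M_{kms}(\Pi,Z(\delta))$. Let $\eta_1=1/\mathcal M_{inter}(\Pi,Z)$, $\eta_2=\mathcal M_{intra}(\Pi,Z)/\mathcal M_{inter}(\Pi,Z)$ and $\Upsilon=(1+\eta_2)H_\Pi-I-\frac{\eta_2}{N}\mathbf 1\mathbf 1^\top$, where $(H_\Pi)_{xx'}=1/|\pi|$ if $x,x'$ lie in the same class $\pi$ and $0$ otherwise. **Theorem.** For all $k\in\mathbb N$, $a>0$, $G_0>1$ and $B>0$ there are constants $C,\delta_0>0$, depending only on $k,a,G_0,B$, such that the following holds for all data as above (with any $N\ge k$) for which $\mathcal M_{inter}(\Pi,Z)>0$, $\eta_1\le B$, $\lambda_k^{(u)}\ge a$ and $\mathcal G_k\ge G_0$. 1. $\Upsilon$ encodes the ground-truth clustering: for $x\ne x'$ with the same label, $\Upsilon_{xx'}>0$; and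 if $\mathcal M_{intra}(\Pi,Z)>0$, then $\Upsilon_{xx'}<0$ for $x,x'$ with different labels. 2. For all $0<\delta\le\delta_0$ one has $\mathcal M_{inter}(\Pi,Z(\delta))>0$ and $$\left|\Delta_{kms}(\delta)-\delta\,\eta_1\operatorname{Tr}\!\left(\Upsilon\left(V_k^{(u)}V_k^{(u)\top}\mathfrak l\mathfrak l^\top\bigl(I+V_\varnothing^{(u)}V_\varnothing^{(u)\top}\bigr)-2\tilde A_k^{(u)}\,\mathrm{diag}(\mathfrak l)\right)\right)\right|\le C\left(\frac1{\mathcal G_k}+\delta^2\right).$$ -/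

import Mathlib

open MeasureTheory ProbabilityTheory
open scoped Matrix ENNReal

noncomputable section

namespace SORL

/-! ### The augmentation graph -/

/-- Self-supervised adjacency matrix `A⁽ᵘ⁾`: the entry at `(x, x')` is
`𝔼_{x̄ ∼ P} T(x | x̄) T(x' | x̄)`, where `T(· | x̄)` is the law of an augmentation of `x̄`. -/
def selfSupAdj {Xbar : Type*} [MeasurableSpace Xbar] {N : ℕ}
    (P : Measure Xbar) (T : Kernel Xbar (Fin N)) : Matrix (Fin N) (Fin N) ℝ :=
  Matrix.of fun x x' => ∫ xb, (T xb).real {x} * (T xb).real {x'} ∂P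

/-- The vector `𝔩` of semantic connections to the labeled data (one labeled class, with
distribution `Pl`): `𝔩_x = 𝔼_{x̄ ∼ Pl} T(x | x̄)`. -/
def labelVec {Xbar : Type*} [MeasurableSpace Xbar] {N : ℕ}
    (Pl : Measure Xbar) (T : Kernel Xbar (Fin N)) : Fin N → ℝ :=
  fun x => ∫ xb, (T xb).real {x} ∂Pl

/-- The perturbed adjacency matrix `A(δ) = η_u A⁽ᵘ⁾ + δ 𝔩 𝔩ᵀ`. -/
def adj {Xbar : Type*} [MeasurableSpace Xbar] {N : ℕ} (ηu : ℝ) (P Pl : Measure Xbar)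
    (T : Kernel Xbar (Fin N)) (δ : ℝ) : Matrix (Fin N) (Fin N) ℝ :=
  ηu • selfSupAdj P T + δ • Matrix.vecMulVec (labelVec Pl T) (labelVec Pl T)

/-- Degree of a vertex: row sum of the adjacency matrix. -/
def degree {N : ℕ} (A : Matrix (Fin N) (Fin N) ℝ) (x : Fin N) : ℝ := ∑ x', A x x'

/-- `D^{-1/2}`, with `D` the diagonal matrix of degrees. -/
def invSqrtDeg {N : ℕ} (A : Matrix (Fin N) (Fin N) ℝ) : Matrix (Fin N) (Fin N) ℝ :=
  Matrix.diagonal fun x => (Real.sqrt (degree A x))⁻¹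

/-- The normalized adjacency matrix `D^{-1/2} A D^{-1/2}`. -/
def normAdj {N : ℕ} (A : Matrix (Fin N) (Fin N) ℝ) : Matrix (Fin N) (Fin N) ℝ :=
  invSqrtDeg A * A * invSqrtDeg A

/-! ### Singular value decomposition and spectral representation -/

/-- `M = ∑ⱼ σⱼ vⱼ vⱼᵀ` is a singular value decomposition of the symmetric positive semidefinite
matrix `M`: the `vⱼ` (columns of `V`) are orthonormal and the `σⱼ` are nonnegative and listed in
nonincreasing order. -/
structure IsSVD {N : ℕ} (M V : Matrix (Fin N) (Fin N) ℝ) (σ : Fin N → ℝ) : Prop where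
  orthonormal : Vᵀ * V = 1
  nonneg : ∀ j, 0 ≤ σ j
  antitone : Antitone σ
  decomp : M = V * Matrix.diagonal σ * Vᵀ

/-- The `j`-th singular value `λ_j`, counted from `1`; there is none (value `0`) for `j = 0` and
for `j > N`. -/
def singVal {N : ℕ} (σ : Fin N → ℝ) (j : ℕ) : ℝ :=
  if h : 1 ≤ j ∧ j ≤ N then σ ⟨j - 1, by omega⟩ else 0

/-- The spectral gap `𝒢_k = λ_k / λ_{k+1}`; it is `∞` if `λ_k > 0 = λ_{k+1}`. -/
def spectralGap {N : ℕ} (σ : Fin N → ℝ) (k : ℕ) : ℝ≥0∞ :=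
  ENNReal.ofReal (singVal σ k) / ENNReal.ofReal (singVal σ (k + 1))

/-- `V_k`: the first `k` columns of `V`. -/
def topVec {N k : ℕ} (hk : k ≤ N) (V : Matrix (Fin N) (Fin N) ℝ) : Matrix (Fin N) (Fin k) ℝ :=
  V.submatrix id (Fin.castLE hk)

/-- The first `k` singular values, i.e. the diagonal of `Σ_k`. -/
def topVal {N k : ℕ} (hk : k ≤ N) (σ : Fin N → ℝ) : Fin k → ℝ := fun j => σ (Fin.castLE hk j)

/-- The rank-`k` approximation `V_k Σ_k V_kᵀ`. -/
def rankApprox {N k : ℕ} (hk : k ≤ N) (V : Matrix (Fin N) (Fin N) ℝ) (σ : Fin N → ℝ) :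
    Matrix (Fin N) (Fin N) ℝ :=
  topVec hk V * Matrix.diagonal (topVal hk σ) * (topVec hk V)ᵀ

/-- The representation `Z = D^{-1/2} V_k √Σ_k` computed from the graph `A`. -/
def rep {N k : ℕ} (hk : k ≤ N) (A V : Matrix (Fin N) (Fin N) ℝ) (σ : Fin N → ℝ) :
    Matrix (Fin N) (Fin k) ℝ :=
  invSqrtDeg A * topVec hk V * Matrix.diagonal fun j => Real.sqrt (topVal hk σ j)

/-- The columns of `W` are an orthonormal basis of the null space of `V_kᵀ`. -/
def IsNullBasis {N k : ℕ} (Vk : Matrix (Fin N) (Fin k) ℝ) (W : Matrix (Fin N) (Fin (N - k)) ℝ) :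
    Prop :=
  Wᵀ * W = 1 ∧ Vkᵀ * W = 0

/-! ### The K-means measure -/

/-- The average of the feature vectors (rows of `Z`) with index in `s`. -/
def center {N k : ℕ} (Z : Matrix (Fin N) (Fin k) ℝ) (s : Finset (Fin N)) : Fin k → ℝ :=
  fun j => (s.card : ℝ)⁻¹ * ∑ i ∈ s, Z i j

/-- Intra-class measure `∑_π ∑_{i ∈ π} ‖z_i - μ_π‖²` (Euclidean norm). -/
def intra {N k : ℕ} (cls : Finpartition (Finset.univ : Finset (Fin N)))
    (Z : Matrix (Fin N) (Fin k) ℝ) : ℝ :=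
  ∑ s ∈ cls.parts, ∑ i ∈ s, ‖WithLp.toLp 2 (fun j => Z i j - center Z s j)‖ ^ 2

/-- Inter-class measure `∑_π |π| ‖μ_π - μ_Π‖²` (Euclidean norm). -/
def inter {N k : ℕ} (cls : Finpartition (Finset.univ : Finset (Fin N)))
    (Z : Matrix (Fin N) (Fin k) ℝ) : ℝ :=
  ∑ s ∈ cls.parts, (s.card : ℝ) * ‖WithLp.toLp 2 (fun j => center Z s j - center Z Finset.univ j)‖ ^ 2

/-- The K-means measure. -/
def kms {N k : ℕ} (cls : Finpartition (Finset.univ : Finset (Fin N)))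
    (Z : Matrix (Fin N) (Fin k) ℝ) : ℝ :=
  intra cls Z / inter cls Z

/-- `η₁ = 1 / M_inter(Π, Z)`. -/
def eta1 {N k : ℕ} (cls : Finpartition (Finset.univ : Finset (Fin N)))
    (Z : Matrix (Fin N) (Fin k) ℝ) : ℝ :=
  1 / inter cls Z

/-- `η₂ = M_intra(Π, Z) / M_inter(Π, Z)`. -/
def eta2 {N k : ℕ} (cls : Finpartition (Finset.univ : Finset (Fin N)))
    (Z : Matrix (Fin N) (Fin k) ℝ) : ℝ :=
  intra cls Z / inter cls Z

/-- The class-averaging matrix `H_Π`: its entry at `(x, x')` is `1 / |π|` if `x` and `x'` both lie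
in the class `π`, and `0` if they lie in different classes. -/
def classAvg {N : ℕ} (cls : Finpartition (Finset.univ : Finset (Fin N))) :
    Matrix (Fin N) (Fin N) ℝ :=
  Matrix.of fun x x' => if x' ∈ cls.part x then 1 / ((cls.part x).card : ℝ) else 0

/-- `Υ = (1 + η₂) H_Π - I - (η₂ / N) 𝟏 𝟏ᵀ`. -/
def upsilon {N k : ℕ} (cls : Finpartition (Finset.univ : Finset (Fin N)))
    (Z : Matrix (Fin N) (Fin k) ℝ) : Matrix (Fin N) (Fin N) ℝ :=
  (1 + eta2 cls Z) • classAvg cls - 1 - (eta2 cls Z / (N : ℝ)) • Matrix.of fun _ _ => (1 : ℝ)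

/-- The first-order coefficient
`η₁ Tr(Υ (V_k V_kᵀ 𝔩 𝔩ᵀ (I + V_∅ V_∅ᵀ) - 2 Ã_k diag(𝔩)))`, with `V_∅ = W`. -/
def mainCoeff {N k : ℕ} (hk : k ≤ N) (cls : Finpartition (Finset.univ : Finset (Fin N)))
    (Z : Matrix (Fin N) (Fin k) ℝ) (l : Fin N → ℝ) (V : Matrix (Fin N) (Fin N) ℝ)
    (σ : Fin N → ℝ) (W : Matrix (Fin N) (Fin (N - k)) ℝ) : ℝ :=
  eta1 cls Z * Matrix.trace (upsilon cls Z *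
    (topVec hk V * (topVec hk V)ᵀ * Matrix.vecMulVec l l * (1 + W * Wᵀ)
      - (2 : ℝ) • (rankApprox hk V σ * Matrix.diagonal l)))

end SORL

end

/-!
With the within-class and between-class orthogonal projections, `intra` and `inter` are the traces
of these projections against the Gram matrix `Z Zᵀ`, and `Z Zᵀ = D^{-1/2} X D^{-1/2}`, where `X` is
the part of the normalized adjacency matrix carried by its `k` leading eigenvectors.
Adding `δ 𝔩 𝔩ᵀ` moves the normalized adjacency matrix by `O(δ)` in operator norm, uniformly in `N`,
because the degrees were `1` and `𝔩` is a probability vector. By Weyl's inequality and the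
Davis–Kahan bound the leading eigenspace then turns by `O(δ)`. To first order, the truncation `X`
changes by the compression of the perturbation that discards its block on the trailing eigenspace;
the trailing eigenvalues, of size at most `1 / 𝒢_k`, and the quadratic terms make up the error.
All the Gram matrices and their derivative have rank `O(k)`, so traces of the error terms are
bounded by their operator norms at a cost that does not depend on `N`. The K-means measure is the
quotient of the two traces and is expanded accordingly.
-/

noncomputable section

namespace SORL

open scoped Matrix.Norms.L2Operator

section Rank

variable {𝕜 m n : Type*} [Field 𝕜] [Fintype n]

theorem rank_add_le (A B : Matrix m n 𝕜) : (A + B).rank ≤ A.rank + B.rank := by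
  rw [Matrix.rank, Matrix.mulVecLin_add]
  exact (Submodule.finrank_mono (LinearMap.range_add_le _ _)).trans
    (Submodule.finrank_add_le_finrank_add_finrank _ _)

theorem rank_sub_le (A B : Matrix m n 𝕜) : (A - B).rank ≤ A.rank + B.rank := by
  have hneg : (-B).rank = B.rank := by
    rw [Matrix.rank, show (-B).mulVecLin = -B.mulVecLin by ext; simp, LinearMap.range_neg,
      Matrix.rank]
  rw [sub_eq_add_neg, ← hneg]
  exact rank_add_le A (-B)

end Rank

section TraceRank

variable {𝕜 E : Type*} [RCLike 𝕜] [NormedAddCommGroup E] [InnerProductSpace 𝕜 E]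
  [FiniteDimensional 𝕜 E]

theorem norm_trace_le_finrank_range_mul_norm (T : E →L[𝕜] E) :
    ‖LinearMap.trace 𝕜 E T‖ ≤ Module.finrank 𝕜 (LinearMap.range (T : E →ₗ[𝕜] E)) * ‖T‖ := by
  set p := LinearMap.range (T : E →ₗ[𝕜] E)
  let b := stdOrthonormalBasis 𝕜 p
  have hT : ∀ x, (T : E →ₗ[𝕜] E) x ∈ p := LinearMap.mem_range_self _
  rw [← LinearMap.trace_restrict_eq_of_forall_mem p _ hT, LinearMap.trace_eq_sum_inner _ b]
  have hinner (i) : ‖inner 𝕜 (b i) ((T : E →ₗ[𝕜] E).restrict (fun x _ => hT x) (b i))‖ ≤ ‖T‖ :=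
    calc _ ≤ ‖(b i : E)‖ * ‖T (b i)‖ := norm_inner_le_norm (𝕜 := 𝕜) (b i : E) (T (b i))
      _ ≤ 1 * (‖T‖ * 1) := by
        have hb : ‖(b i : E)‖ = 1 := b.norm_eq_one i
        simpa only [hb] using mul_le_mul_of_nonneg_left (T.le_opNorm (b i)) zero_le_one
      _ = ‖T‖ := by ring
  calc _ ≤ ∑ _i, ‖T‖ := norm_sum_le_of_le _ fun i _ => hinner i
    _ = _ := by simp

variable {n : Type*} [Fintype n] [DecidableEq n]

theorem norm_trace_le_rank_mul_norm (A : Matrix n n 𝕜) : ‖A.trace‖ ≤ A.rank * ‖A‖ := by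
  let b := (EuclideanSpace.basisFun n 𝕜).toBasis
  have htrace : A.trace =
      LinearMap.trace 𝕜 (EuclideanSpace 𝕜 n) (Matrix.toEuclideanCLM (𝕜 := 𝕜) A) :=
    (Matrix.trace_toLin_eq A b).symm
  rw [htrace, Matrix.rank_eq_finrank_range_toLin A b b]
  exact norm_trace_le_finrank_range_mul_norm _

theorem norm_trace_mul_le {S Y : Matrix n n 𝕜} {r : ℕ} {e : ℝ} (hS : ‖S‖ ≤ 1) (hr : Y.rank ≤ r)
    (he : ‖Y‖ ≤ e) : ‖(S * Y).trace‖ ≤ r * e :=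
  have h := norm_mul_le_of_le hS he
  calc ‖(S * Y).trace‖ ≤ (S * Y).rank * ‖S * Y‖ := norm_trace_le_rank_mul_norm _
    _ ≤ r * e := by
      gcongr
      · exact (Matrix.rank_mul_le_right S Y).trans hr
      · simpa using h

end TraceRank

section Spectral

open Matrix

variable {n : Type*} [Fintype n] [DecidableEq n]

theorem dotProduct_mulVec_self_le (A : Matrix n n ℝ) (x : n → ℝ) :
    x ⬝ᵥ A *ᵥ x ≤ ‖A‖ * (x ⬝ᵥ x) := by
  have hdot (y z : n → ℝ) : y ⬝ᵥ z = inner ℝ (WithLp.toLp 2 z) (WithLp.toLp 2 y) := by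
    simp [EuclideanSpace.inner_toLp_toLp]
  calc x ⬝ᵥ A *ᵥ x ≤ ‖WithLp.toLp 2 (A *ᵥ x)‖ * ‖WithLp.toLp 2 x‖ :=
        hdot x _ ▸ real_inner_le_norm _ _
    _ ≤ ‖A‖ * ‖WithLp.toLp 2 x‖ * ‖WithLp.toLp 2 x‖ := by
        gcongr
        exact A.l2_opNorm_mulVec (WithLp.toLp 2 x)
    _ = ‖A‖ * (x ⬝ᵥ x) := by rw [hdot, real_inner_self_eq_norm_mul_norm]; ring

theorem norm_diagonal_le {f : n → ℝ} {c : ℝ} (hc : 0 ≤ c) (hf : ∀ i, |f i| ≤ c) :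
    ‖diagonal f‖ ≤ c := by
  rw [l2_opNorm_diagonal]
  exact (pi_norm_le_iff_of_nonneg hc).2 hf

theorem norm_one_le : ‖(1 : Matrix n n ℝ)‖ ≤ 1 :=
  IsStarProjection.norm_le _ (.one _)

theorem norm_mul_comm_of_isSelfAdjoint {R : Type*} [NonUnitalNormedRing R] [StarRing R]
    [NormedStarGroup R] {x y : R} (hx : IsSelfAdjoint x) (hy : IsSelfAdjoint y) :
    ‖x * y‖ = ‖y * x‖ := by
  rw [← norm_star, star_mul, hx.star_eq, hy.star_eq]

/-- The functional calculus of the orthonormal eigenbasis given by the columns `uᵢ` of `U`: it sends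
`f` to `∑ᵢ f i • uᵢ uᵢᵀ`. -/
def spectralHom (U : unitary (Matrix n n ℝ)) : (n → ℝ) →⋆ₐ[ℝ] Matrix n n ℝ :=
  (Unitary.conjStarAlgAut ℝ (Matrix n n ℝ) U : Matrix n n ℝ →⋆ₐ[ℝ] Matrix n n ℝ).comp
    { diagonalAlgHom ℝ with map_star' := fun f => by simp [star_eq_conjTranspose] }

theorem spectralHom_apply (U : unitary (Matrix n n ℝ)) (f : n → ℝ) :
    spectralHom U f = U * diagonal f * star (U : Matrix n n ℝ) := rfl

theorem norm_spectralHom (U : unitary (Matrix n n ℝ)) (f : n → ℝ) : ‖spectralHom U f‖ = ‖f‖ := by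
  rw [spectralHom_apply, ← Unitary.coe_star, CStarRing.norm_mul_coe_unitary,
    CStarRing.norm_coe_unitary_mul, l2_opNorm_diagonal]

theorem norm_spectralHom_le (U : unitary (Matrix n n ℝ)) {f : n → ℝ} {c : ℝ} (hc : 0 ≤ c)
    (hf : ∀ i, |f i| ≤ c) : ‖spectralHom U f‖ ≤ c :=
  (norm_spectralHom U f).trans_le ((pi_norm_le_iff_of_nonneg hc).2 hf)

theorem dotProduct_spectralHom_mulVec (U : unitary (Matrix n n ℝ)) (f x : n → ℝ) :
    x ⬝ᵥ spectralHom U f *ᵥ x = ∑ i, f i * (star (U : Matrix n n ℝ) *ᵥ x) i ^ 2 := by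
  rw [spectralHom_apply, star_eq_conjTranspose, conjTranspose_eq_transpose_of_trivial,
    ← mulVec_mulVec, ← mulVec_mulVec, dotProduct_mulVec, ← mulVec_transpose]
  simp only [dotProduct, mulVec_diagonal]
  exact Finset.sum_congr rfl fun i _ => by ring

theorem dotProduct_spectralHom_mulVec_mono (U : unitary (Matrix n n ℝ)) {f g x : n → ℝ}
    (h : ∀ i, (star (U : Matrix n n ℝ) *ᵥ x) i ≠ 0 → f i ≤ g i) :
    x ⬝ᵥ spectralHom U f *ᵥ x ≤ x ⬝ᵥ spectralHom U g *ᵥ x := by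
  simp only [dotProduct_spectralHom_mulVec]
  refine Finset.sum_le_sum fun i _ => ?_
  rcases eq_or_ne ((star (U : Matrix n n ℝ) *ᵥ x) i) 0 with hi | hi
  · simp [hi]
  · exact mul_le_mul_of_nonneg_right (h i hi) (sq_nonneg _)

theorem dotProduct_spectralHom_const_mulVec (U : unitary (Matrix n n ℝ)) (c : ℝ) (x : n → ℝ) :
    x ⬝ᵥ spectralHom U (Function.const n c) *ᵥ x = c * (x ⬝ᵥ x) := by
  have : Function.const n c = c • (1 : n → ℝ) := by ext; simp
  simp [this, smul_mulVec]

theorem exists_ne_zero_mulVec_eq_zero {K n : Type*} [Field K] [Fintype n] [LinearOrder n]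
    (A B : Matrix n n K) (i : n) :
    ∃ x ≠ 0, (∀ j < i, (A *ᵥ x) j = 0) ∧ ∀ j, i < j → (B *ᵥ x) j = 0 := by
  let φ : (n → K) →ₗ[K] n → K := LinearMap.pi fun j =>
    if j < i then LinearMap.proj j ∘ₗ A.mulVecLin
    else if i < j then LinearMap.proj j ∘ₗ B.mulVecLin else 0
  have hφ : LinearMap.ker φ ≠ ⊥ := fun h => by
    obtain ⟨x, hx⟩ := LinearMap.injective_iff_surjective.1 (LinearMap.ker_eq_bot.1 h) 1
    simpa [φ] using congrFun hx i
  obtain ⟨x, hx, hx0⟩ := Submodule.exists_mem_ne_zero_of_ne_bot hφ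
  have hx (j) : φ x j = 0 := congrFun hx j
  exact ⟨x, hx0, fun j hj => by simpa [φ, hj] using hx j,
    fun j hj => by simpa [φ, hj, hj.not_gt] using hx j⟩

theorem le_add_norm_spectralHom_sub {n : Type*} [Fintype n] [LinearOrder n]
    (U U' : unitary (Matrix n n ℝ)) {f f' : n → ℝ} (hf : Antitone f) (hf' : Antitone f') (i : n) :
    f' i ≤ f i + ‖spectralHom U' f' - spectralHom U f‖ := by
  obtain ⟨x, hx0, hlow, hhigh⟩ := exists_ne_zero_mulVec_eq_zero
    (star (U : Matrix n n ℝ)) (star (U' : Matrix n n ℝ)) i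
  have hpos : 0 < x ⬝ᵥ x := by simpa using dotProduct_star_self_pos_iff.2 hx0
  refine le_of_mul_le_mul_right ?_ hpos
  calc f' i * (x ⬝ᵥ x) ≤ x ⬝ᵥ spectralHom U' f' *ᵥ x := by
        rw [← dotProduct_spectralHom_const_mulVec U']
        exact dotProduct_spectralHom_mulVec_mono U' fun j hj => hf' (not_lt.1 (mt (hhigh j) hj))
    _ = x ⬝ᵥ spectralHom U f *ᵥ x + x ⬝ᵥ (spectralHom U' f' - spectralHom U f) *ᵥ x := by
        rw [sub_mulVec, dotProduct_sub]; ring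
    _ ≤ f i * (x ⬝ᵥ x) + ‖spectralHom U' f' - spectralHom U f‖ * (x ⬝ᵥ x) := by
        gcongr
        · rw [← dotProduct_spectralHom_const_mulVec U]
          exact dotProduct_spectralHom_mulVec_mono U fun j hj => hf (not_lt.1 (mt (hlow j) hj))
        · exact dotProduct_mulVec_self_le _ x
    _ = (f i + ‖spectralHom U' f' - spectralHom U f‖) * (x ⬝ᵥ x) := by ring

/-- The orthogonal projection `∑_{i ∈ s} uᵢ uᵢᵀ` onto the span of the columns of `U` with index in
`s`. -/
def spectralProj (U : unitary (Matrix n n ℝ)) (s : Set n) : Matrix n n ℝ :=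
  spectralHom U (s.indicator 1)

section spectralProj

variable (U U' : unitary (Matrix n n ℝ)) (s : Set n) {f f' : n → ℝ} {a b : ℝ}

theorem isStarProjection_spectralProj : IsStarProjection (spectralProj U s) := by
  refine IsStarProjection.map ⟨?_, ?_⟩ (spectralHom U)
  · ext i; by_cases hi : i ∈ s <;> simp [hi]
  · exact .all _

theorem norm_spectralProj_le : ‖spectralProj U s‖ ≤ 1 :=
  IsStarProjection.norm_le _ (isStarProjection_spectralProj U s)

theorem spectralProj_compl : spectralProj U sᶜ = 1 - spectralProj U s := by
  rw [spectralProj, Set.indicator_compl, map_sub, map_one, spectralProj]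

theorem spectralProj_mul_spectralHom (f : n → ℝ) :
    spectralProj U s * spectralHom U f = spectralHom U (s.indicator f) := by
  rw [spectralProj, ← map_mul]
  congr 1
  ext i; by_cases hi : i ∈ s <;> simp [hi]

theorem commute_spectralProj_spectralHom (f : n → ℝ) :
    Commute (spectralProj U s) (spectralHom U f) :=
  (Commute.all _ f).map (spectralHom U)

variable {s}

theorem mul_norm_mul_spectralProj_le (M : Matrix n n ℝ) (ha : 0 < a) (hf : ∀ i ∈ s, a ≤ f i) :
    a * ‖M * spectralProj U s‖ ≤ ‖M * spectralProj U s * spectralHom U f‖ := by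
  have hinv : spectralProj U s =
      spectralProj U s * spectralHom U f * spectralHom U (s.indicator f⁻¹) := by
    rw [mul_assoc, ← map_mul, spectralProj_mul_spectralHom, spectralProj]
    congr 1
    ext i
    by_cases hi : i ∈ s
    · simp [hi, (ha.trans_le (hf i hi)).ne']
    · simp [hi]
  have hinv_le : ‖spectralHom U (s.indicator f⁻¹)‖ ≤ a⁻¹ := by
    refine norm_spectralHom_le U (by positivity) fun i => ?_
    by_cases hi : i ∈ s
    · simpa [hi, abs_of_pos (ha.trans_le (hf i hi))] using inv_anti₀ ha (hf i hi)
    · simp [hi, ha.le]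
  rw [← le_inv_mul_iff₀ ha, mul_comm]
  calc ‖M * spectralProj U s‖
      = ‖M * spectralProj U s * spectralHom U f * spectralHom U (s.indicator f⁻¹)‖ := by
        rw [mul_assoc M, mul_assoc M, ← hinv]
    _ ≤ _ := norm_mul_le_of_le le_rfl hinv_le

theorem norm_spectralHom_mul_spectralProj_mul_le (M : Matrix n n ℝ) (hb : 0 ≤ b)
    (hf : ∀ i ∈ s, |f i| ≤ b) :
    ‖spectralHom U f * (spectralProj U s * M)‖ ≤ b * ‖spectralProj U s * M‖ := by
  have hidem : spectralProj U s * (spectralProj U s * M) = spectralProj U s * M := by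
    rw [← mul_assoc, (isStarProjection_spectralProj U s).isIdempotentElem.eq]
  rw [← hidem, ← mul_assoc, ← (commute_spectralProj_spectralHom U s f).eq,
    spectralProj_mul_spectralHom, hidem]
  refine norm_mul_le_of_le (norm_spectralHom_le U hb fun i => ?_) le_rfl
  by_cases hi : i ∈ s
  · simpa [hi] using hf i hi
  · simpa [hi] using hb

theorem sub_mul_norm_spectralProj_compl_mul_le (ha : 0 < a) (hb : 0 ≤ b) (hf : ∀ i ∈ s, a ≤ f i)
    (hf' : ∀ i ∉ s, |f' i| ≤ b) :
    (a - b) * ‖spectralProj U' sᶜ * spectralProj U s‖ ≤ ‖spectralHom U' f' - spectralHom U f‖ := by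
  set p := spectralProj U s
  set q' := spectralProj U' sᶜ
  have hcomm : q' * p * spectralHom U f = spectralHom U' f' * (q' * p)
      - q' * (spectralHom U' f' - spectralHom U f) * p := by
    rw [mul_sub, sub_mul, (commute_spectralProj_spectralHom U' sᶜ f').eq, mul_assoc q',
      (commute_spectralProj_spectralHom U s f).eq]
    noncomm_ring
  have hsandwich : ‖q' * (spectralHom U' f' - spectralHom U f) * p‖
      ≤ ‖spectralHom U' f' - spectralHom U f‖ := by
    simpa using norm_mul_le_of_le (norm_mul_le_of_le (norm_spectralProj_le U' sᶜ) le_rfl)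
      (norm_spectralProj_le U s)
  have hlower := mul_norm_mul_spectralProj_le U q' ha hf
  have hupper := norm_spectralHom_mul_spectralProj_mul_le U' (s := sᶜ) p hb hf'
  have htriangle := norm_sub_le (spectralHom U' f' * (q' * p))
    (q' * (spectralHom U' f' - spectralHom U f) * p)
  rw [← hcomm] at htriangle
  linarith

theorem norm_spectralProj_compl_sub_le {r : ℝ} (h : ‖spectralProj U' sᶜ * spectralProj U s‖ ≤ r)
    (h' : ‖spectralProj U sᶜ * spectralProj U' s‖ ≤ r) :
    ‖spectralProj U' sᶜ - spectralProj U sᶜ‖ ≤ 2 * r := by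
  have hsplit : spectralProj U' sᶜ - spectralProj U sᶜ =
      spectralProj U' sᶜ * spectralProj U s - spectralProj U' s * spectralProj U sᶜ := by
    simp only [spectralProj_compl]
    noncomm_ring
  have hflip : ‖spectralProj U' s * spectralProj U sᶜ‖ =
      ‖spectralProj U sᶜ * spectralProj U' s‖ :=
    norm_mul_comm_of_isSelfAdjoint (isStarProjection_spectralProj U' s).isSelfAdjoint
      (isStarProjection_spectralProj U sᶜ).isSelfAdjoint
  calc _ ≤ r + r := hsplit ▸ norm_sub_le_of_le h (hflip.trans_le h')
    _ = 2 * r := by ring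

theorem norm_spectralHom_indicator_le : ‖spectralHom U (s.indicator f)‖ ≤ ‖spectralHom U f‖ := by
  simpa [spectralProj_mul_spectralHom] using
    norm_mul_le_of_le (norm_spectralProj_le U s) (le_refl ‖spectralHom U f‖)

theorem norm_spectralProj_mul_spectralHom_mul_le {c r : ℝ}
    (h : ‖spectralProj U' sᶜ * spectralProj U s‖ ≤ r) (hf : ‖spectralHom U (s.indicator f)‖ ≤ c) :
    ‖spectralProj U' sᶜ * spectralHom U (s.indicator f) * spectralProj U' sᶜ‖ ≤ c * r ^ 2 := by
  have hfactor : spectralHom U (s.indicator f) =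
      spectralProj U s * spectralHom U (s.indicator f) * spectralProj U s := by
    rw [mul_assoc, ← (commute_spectralProj_spectralHom U s _).eq, spectralProj_mul_spectralHom,
      spectralProj_mul_spectralHom, Set.indicator_indicator, Set.indicator_indicator,
      Set.inter_self, Set.inter_self]
  have hflip : ‖spectralProj U s * spectralProj U' sᶜ‖ ≤ r :=
    (norm_mul_comm_of_isSelfAdjoint (isStarProjection_spectralProj U s).isSelfAdjoint
      (isStarProjection_spectralProj U' sᶜ).isSelfAdjoint).trans_le h
  calc _ = ‖spectralProj U' sᶜ * spectralProj U s * spectralHom U (s.indicator f)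
          * (spectralProj U s * spectralProj U' sᶜ)‖ := by
        conv_lhs => rw [hfactor]
        simp only [mul_assoc]
    _ ≤ r * c * r := norm_mul_le_of_le (norm_mul_le_of_le h hf) hflip
    _ = c * r ^ 2 := by ring

/-- The part of `x` left after removing its compression to the complementary projection `q`: if `q`
projects onto the span of some eigenvectors of a self-adjoint `x`, these eigenvalues are set to
`0`. -/
def truncate {R : Type*} [Ring R] (q x : R) : R := x - q * x * q

theorem truncate_spectralHom (f : n → ℝ) :
    truncate (spectralProj U sᶜ) (spectralHom U f) = spectralHom U (s.indicator f) := by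
  have hcompl : s.indicator f = f - sᶜ.indicator f := by rw [Set.indicator_compl]; simp
  rw [truncate, spectralProj_mul_spectralHom, ← (commute_spectralProj_spectralHom U sᶜ _).eq,
    spectralProj_mul_spectralHom, Set.indicator_indicator, Set.inter_self, hcompl, map_sub]

end spectralProj

section Gap

/-- The nonnegative level `b` and the width `g > 0` witness a spectral gap separating the
eigenvalues `f i`, `i ∈ s`, from the smaller ones. -/
structure HasGap {n : Type*} (f : n → ℝ) (s : Set n) (b g : ℝ) : Prop where
  nonneg : 0 ≤ b
  pos : 0 < g
  add_le : ∀ i ∈ s, b + g ≤ f i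
  le : ∀ i ∉ s, f i ≤ b

variable {n : Type*} [Fintype n] [LinearOrder n] {U U' : unitary (Matrix n n ℝ)} {s : Set n}
  {f f' : n → ℝ} {b e g : ℝ}

theorem HasGap.norm_spectralProj_compl_mul_le (h : HasGap f s b g) (hf : Antitone f)
    (hf' : Antitone f') (hf'0 : ∀ i, 0 ≤ f' i) (he : ‖spectralHom U' f' - spectralHom U f‖ ≤ e)
    (heg : 2 * e ≤ g) : ‖spectralProj U' sᶜ * spectralProj U s‖ ≤ 2 * e / g := by
  have hf's : ∀ i ∉ s, |f' i| ≤ b + e := fun i hi => by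
    rw [abs_of_nonneg (hf'0 i)]
    linarith [le_add_norm_spectralHom_sub U U' hf hf' i, h.le i hi]
  have hb := h.nonneg
  have hg := h.pos
  have he0 : 0 ≤ e := (norm_nonneg _).trans he
  have hsin := (sub_mul_norm_spectralProj_compl_mul_le U U' (by linarith) (by linarith) h.add_le
    hf's).trans he
  have hhalf : g / 2 ≤ b + g - (b + e) := by linarith
  rw [le_div_iff₀ hg]
  linarith [mul_le_mul_of_nonneg_right hhalf (norm_nonneg (spectralProj U' sᶜ * spectralProj U s))]

theorem HasGap.norm_spectralProj_compl_mul_le' (h : HasGap f s b g) (hf : Antitone f)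
    (hf' : Antitone f') (hf0 : ∀ i, 0 ≤ f i) (he : ‖spectralHom U' f' - spectralHom U f‖ ≤ e)
    (heg : 2 * e ≤ g) : ‖spectralProj U sᶜ * spectralProj U' s‖ ≤ 2 * e / g := by
  rw [norm_sub_rev] at he
  have hf's : ∀ i ∈ s, b + g - e ≤ f' i := fun i hi => by
    linarith [le_add_norm_spectralHom_sub U' U hf' hf i, h.add_le i hi]
  have hfs : ∀ i ∉ s, |f i| ≤ b := fun i hi => (abs_of_nonneg (hf0 i)).trans_le (h.le i hi)
  have hb := h.nonneg
  have hg := h.pos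
  have hsin := (sub_mul_norm_spectralProj_compl_mul_le U' U (by linarith) hb hf's hfs).trans he
  have hhalf : g / 2 ≤ b + g - e - b := by linarith
  rw [le_div_iff₀ hg]
  linarith [mul_le_mul_of_nonneg_right hhalf (norm_nonneg (spectralProj U sᶜ * spectralProj U' s))]

theorem HasGap.norm_spectralHom_indicator_compl_le (h : HasGap f s b g) (hf0 : ∀ i, 0 ≤ f i)
    (U : unitary (Matrix n n ℝ)) : ‖spectralHom U (sᶜ.indicator f)‖ ≤ b := by
  refine norm_spectralHom_le U h.nonneg fun i => ?_
  by_cases hi : i ∈ s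
  · simpa [hi] using h.nonneg
  · simpa [hi, abs_of_nonneg (hf0 i)] using h.le i hi

end Gap

end Spectral

section NormedRing

variable {R : Type*} [NormedRing R] {s l x r b f m y q q' : R} {c δ ε ρ : ℝ}

theorem norm_sandwich_le (hs : ‖s‖ ≤ 1) : ‖s * x * s‖ ≤ ‖x‖ := by
  simpa using norm_mul_le_of_le (norm_mul_le_of_le hs le_rfl) hs

theorem norm_sandwich_sub_sandwich_le (hs : ‖s‖ ≤ 1) (hq : ‖q‖ ≤ 1) :
    ‖s * x * s - q * x * q‖ ≤ 2 * ‖s - q‖ * ‖x‖ := by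
  have hsplit : s * x * s - q * x * q = (s - q) * x * s + q * x * (s - q) := by noncomm_ring
  calc _ ≤ ‖s - q‖ * ‖x‖ * 1 + 1 * ‖x‖ * ‖s - q‖ := hsplit ▸ norm_add_le_of_le
        (norm_mul_le_of_le (norm_mul_le_of_le le_rfl le_rfl) hs)
        (norm_mul_le_of_le (norm_mul_le_of_le hq le_rfl) le_rfl)
    _ = 2 * ‖s - q‖ * ‖x‖ := by ring

theorem norm_sandwich_sub_le (h1 : ‖(1 : R)‖ ≤ 1) (hs : ‖s‖ ≤ 1) :
    ‖s * x * s - x‖ ≤ 2 * ‖s - 1‖ * ‖x‖ := by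
  simpa using norm_sandwich_sub_sandwich_le (x := x) hs h1

theorem norm_sandwich_sub_add_le (hs : ‖s - 1‖ ≤ δ) (hl : ‖s - 1 + l‖ ≤ δ ^ 2) (hx : ‖x‖ ≤ 1) :
    ‖s * x * s - x + (l * x + x * l)‖ ≤ 3 * δ ^ 2 := by
  have hsplit : s * x * s - x + (l * x + x * l)
      = (s - 1) * x * (s - 1) + (s - 1 + l) * x + x * (s - 1 + l) := by noncomm_ring
  calc _ ≤ δ * 1 * δ + δ ^ 2 * 1 + 1 * δ ^ 2 := hsplit ▸ norm_add_le_of_le (norm_add_le_of_le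
        (norm_mul_le_of_le (norm_mul_le_of_le hs hx) hs) (norm_mul_le_of_le hl hx))
        (norm_mul_le_of_le hx hl)
    _ = 3 * δ ^ 2 := by ring

theorem norm_sandwich_add_sub_le (h1 : ‖(1 : R)‖ ≤ 1) (hs : ‖s‖ ≤ 1) (hs1 : ‖s - 1‖ ≤ δ)
    (hx : ‖x‖ ≤ 1) (hb : ‖b‖ ≤ δ) : ‖s * (x + b) * s - x‖ ≤ 3 * δ := by
  have hδ : 0 ≤ δ := (norm_nonneg _).trans hb
  have hsplit : s * (x + b) * s - x = (s * x * s - x) + s * b * s := by noncomm_ring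
  calc _ ≤ 2 * δ * 1 + δ := hsplit ▸ norm_add_le_of_le
        ((norm_sandwich_sub_le h1 hs).trans (by gcongr))
        ((norm_sandwich_le hs).trans hb)
    _ = 3 * δ := by ring

theorem norm_sandwich_add_sub_sub_le (h1 : ‖(1 : R)‖ ≤ 1) (hs : ‖s‖ ≤ 1) (hs1 : ‖s - 1‖ ≤ δ)
    (hl : ‖s - 1 + l‖ ≤ δ ^ 2) (hx : ‖x‖ ≤ 1) (hr : ‖r‖ ≤ ε) (hb : ‖b‖ ≤ δ) :
    ‖s * (x + r + b) * s - x - (b - (l * x + x * l))‖ ≤ ε + 5 * δ ^ 2 := by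
  have hδ : 0 ≤ δ := (norm_nonneg _).trans hb
  have hsplit : s * (x + r + b) * s - x - (b - (l * x + x * l)) =
      s * r * s + (s * x * s - x + (l * x + x * l)) + (s * b * s - b) := by noncomm_ring
  calc _ ≤ ε + 3 * δ ^ 2 + 2 * δ * δ := hsplit ▸ norm_add_le_of_le (norm_add_le_of_le
        ((norm_sandwich_le hs).trans hr) (norm_sandwich_sub_add_le hs1 hl hx))
        ((norm_sandwich_sub_le h1 hs).trans (by gcongr))
    _ = ε + 5 * δ ^ 2 := by ring

theorem norm_truncate_le (hq : ‖q‖ ≤ 1) : ‖truncate q x‖ ≤ 2 * ‖x‖ :=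
  (norm_sub_le_of_le le_rfl (norm_sandwich_le hq)).trans_eq (by ring)

theorem norm_truncate_sub_truncate_le (hq : ‖q‖ ≤ 1) (hq' : ‖q'‖ ≤ 1) :
    ‖truncate q' x - truncate q x‖ ≤ 2 * ‖q' - q‖ * ‖x‖ := by
  have hsub : truncate q' x - truncate q x = q * x * q - q' * x * q' := by
    simp only [truncate]; abel
  rw [hsub, norm_sub_rev q' q]
  exact norm_sandwich_sub_sandwich_le hq hq'

theorem truncate_sub (q x y : R) : truncate q (x - y) = truncate q x - truncate q y := by
  simp only [truncate]; noncomm_ring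

theorem norm_truncate_sub_le (hq : ‖q‖ ≤ 1) (hq' : ‖q'‖ ≤ 1) :
    ‖truncate q' m - truncate q x‖ ≤ 2 * ‖m - x‖ + 2 * ‖q' - q‖ * ‖x‖ := by
  have hsplit : truncate q' m - truncate q x =
      truncate q' (m - x) + (truncate q' x - truncate q x) := by rw [truncate_sub]; abel
  exact hsplit ▸ norm_add_le_of_le (norm_truncate_le hq') (norm_truncate_sub_truncate_le hq hq')

theorem norm_truncate_sub_sub_le (hq : ‖q‖ ≤ 1) (hq' : ‖q'‖ ≤ 1) :
    ‖truncate q' m - x - truncate q f‖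
      ≤ 2 * ‖m - x - f‖ + ‖q' * x * q'‖ + 2 * ‖q' - q‖ * ‖f‖ := by
  have hsplit : truncate q' m - x - truncate q f =
      truncate q' (m - x - f) - q' * x * q' + (truncate q' f - truncate q f) := by
    simp only [truncate]; noncomm_ring
  exact hsplit ▸ norm_add_le_of_le (norm_sub_le_of_le (norm_truncate_le hq') le_rfl)
    (norm_truncate_sub_truncate_le hq hq')

theorem norm_sandwich_truncate_sub_le (h1 : ‖(1 : R)‖ ≤ 1) (hs : ‖s‖ ≤ 1) (hs1 : ‖s - 1‖ ≤ δ)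
    (hy : ‖y‖ ≤ 1) (hx : ‖truncate q y‖ ≤ 1) (hb : ‖b‖ ≤ δ) (hq : ‖q‖ ≤ 1) (hq' : ‖q'‖ ≤ 1)
    (hqq' : ‖q' - q‖ ≤ 2 * c * δ) :
    ‖s * truncate q' (s * (y + b) * s) * s - truncate q y‖ ≤ (8 + 4 * c) * δ := by
  set z := truncate q' (s * (y + b) * s)
  have hδ : 0 ≤ δ := (norm_nonneg _).trans hb
  have hz : ‖z - truncate q y‖ ≤ 2 * (3 * δ) + 2 * (2 * c * δ) * 1 :=
    (norm_truncate_sub_le hq hq').trans <| by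
      have := norm_sandwich_add_sub_le h1 hs hs1 hy hb
      have : 0 ≤ 2 * c * δ := (norm_nonneg _).trans hqq'
      gcongr
  have hsplit : s * z * s - truncate q y =
      s * (z - truncate q y) * s + (s * truncate q y * s - truncate q y) := by noncomm_ring
  calc _ ≤ (2 * (3 * δ) + 2 * (2 * c * δ) * 1) + 2 * δ * 1 := hsplit ▸ norm_add_le_of_le
        ((norm_sandwich_le hs).trans hz) ((norm_sandwich_sub_le h1 hs).trans (by gcongr))
    _ = (8 + 4 * c) * δ := by ring

theorem norm_sandwich_truncate_sub_sub_le (h1 : ‖(1 : R)‖ ≤ 1) (hs : ‖s‖ ≤ 1)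
    (hs1 : ‖s - 1‖ ≤ δ) (hl : ‖s - 1 + l‖ ≤ δ ^ 2) (hlδ : ‖l‖ ≤ δ / 2) (hx : ‖x‖ ≤ 1)
    (hr : ‖r‖ ≤ ε) (hb : ‖b‖ ≤ δ) (hq : ‖q‖ ≤ 1) (hq' : ‖q'‖ ≤ 1) (hqq' : ‖q' - q‖ ≤ 2 * c * δ)
    (hqx : q * x = 0) (hxq : x * q = 0) (hq'x : ‖q' * x * q'‖ ≤ (c * δ) ^ 2) :
    ‖s * truncate q' (s * (x + r + b) * s) * s - x - (truncate q b - 2 * (l * x + x * l))‖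
      ≤ 2 * ε + (21 + 8 * c + c ^ 2) * δ ^ 2 := by
  set m := s * (x + r + b) * s
  set f := b - (l * x + x * l)
  have hδ : 0 ≤ δ := (norm_nonneg _).trans hb
  have hf : ‖f‖ ≤ 2 * δ :=
    (norm_sub_le_of_le hb (norm_add_le_of_le (norm_mul_le_of_le hlδ hx)
      (norm_mul_le_of_le hx hlδ))).trans_eq (by ring)
  have htf : truncate q f = truncate q b - (l * x + x * l) := by
    have hqlxq : q * (l * x + x * l) * q = q * l * (x * q) + (q * x) * l * q := by noncomm_ring
    rw [truncate_sub, truncate, truncate, hqlxq, hqx, hxq]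
    simp
  have htrunc : ‖truncate q' m - x - truncate q f‖
      ≤ 2 * (ε + 5 * δ ^ 2) + (c * δ) ^ 2 + 2 * (2 * c * δ) * (2 * δ) :=
    (norm_truncate_sub_sub_le hq hq').trans <| by
      have := norm_sandwich_add_sub_sub_le h1 hs hs1 hl hx hr hb
      have : 0 ≤ 2 * c * δ := (norm_nonneg _).trans hqq'
      gcongr
  have hsplit : s * truncate q' m * s - x - (truncate q b - 2 * (l * x + x * l)) =
      s * (truncate q' m - x - truncate q f) * s + (s * truncate q f * s - truncate q f)
        + (s * x * s - x + (l * x + x * l)) := by rw [htf]; noncomm_ring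
  calc _ ≤ (2 * (ε + 5 * δ ^ 2) + (c * δ) ^ 2 + 2 * (2 * c * δ) * (2 * δ))
          + 2 * δ * (2 * (2 * δ)) + 3 * δ ^ 2 := hsplit ▸ norm_add_le_of_le (norm_add_le_of_le
        ((norm_sandwich_le hs).trans htrunc)
        ((norm_sandwich_sub_le h1 hs).trans (by grw [norm_truncate_le hq, hs1, hf])))
        (norm_sandwich_sub_add_le hs1 hl hx)
    _ = 2 * ε + (21 + 8 * c + c ^ 2) * δ ^ 2 := by ring

end NormedRing

section Gram

open Matrix

theorem submatrix_mul_diagonal_mul_transpose {m n : Type*} [Fintype m] [DecidableEq m] [Fintype n]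
    [DecidableEq n] {e : m → n} (he : Function.Injective e) (U : unitary (Matrix n n ℝ))
    (f : n → ℝ) :
    (U : Matrix n n ℝ).submatrix id e * diagonal (f ∘ e) * ((U : Matrix n n ℝ).submatrix id e)ᵀ
      = spectralHom U ((Set.range e).indicator f) := by
  ext x y
  simp only [spectralHom_apply, star_eq_conjTranspose, conjTranspose_eq_transpose_of_trivial,
    mul_apply (M := _ * diagonal _), mul_diagonal, transpose_apply, submatrix_apply, id]
  refine Fintype.sum_of_injective e he _ _ (fun i hi => ?_) fun i => ?_
  · rw [Set.indicator_of_notMem hi]; simp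
  · rw [Set.indicator_of_mem (Set.mem_range_self i)]; rfl

variable {N k : ℕ} (hk : k ≤ N) (U : unitary (Matrix (Fin N) (Fin N) ℝ))

theorem rankApprox_eq_spectralHom (σ : Fin N → ℝ) :
    rankApprox hk U σ = spectralHom U ((Set.range (Fin.castLE hk)).indicator σ) :=
  submatrix_mul_diagonal_mul_transpose (Fin.castLE_injective hk) U σ

theorem topVec_mul_transpose :
    topVec hk U * (topVec hk U)ᵀ = spectralProj U (Set.range (Fin.castLE hk)) := by
  have h := submatrix_mul_diagonal_mul_transpose (Fin.castLE_injective hk) U 1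
  rwa [Pi.one_comp, diagonal_one', Matrix.mul_one] at h

theorem transpose_topVec_mul : (topVec hk U)ᵀ * topVec hk U = 1 := by
  have hU : (U : Matrix (Fin N) (Fin N) ℝ)ᵀ * U = 1 := by
    simpa only [star_eq_conjTranspose, conjTranspose_eq_transpose_of_trivial] using
      Unitary.coe_star_mul_self U
  rw [topVec, transpose_submatrix, ← submatrix_mul _ _ _ id _ Function.bijective_id, hU]
  exact submatrix_one _ (Fin.castLE_injective hk)

theorem rank_mul_transpose_self_le {m n R : Type*} [Fintype m] [Fintype n] [CommRing R]
    [StrongRankCondition R] (Z : Matrix m n R) : (Z * Zᵀ).rank ≤ Fintype.card n :=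
  (rank_mul_le_left _ _).trans Z.rank_le_card_width

theorem mul_transpose_eq_spectralProj {W : Matrix (Fin N) (Fin (N - k)) ℝ}
    (hW : IsNullBasis (topVec hk U) W) :
    W * Wᵀ = spectralProj U (Set.range (Fin.castLE hk))ᶜ := by
  have e : Fin N ≃ Fin k ⊕ Fin (N - k) :=
    (finCongr (Nat.add_sub_of_le hk).symm).trans finSumFinEquiv.symm
  have hW' : Wᵀ * topVec hk U = 0 := by
    simpa only [transpose_mul, transpose_transpose, transpose_zero] using congrArg transpose hW.2
  have hcols : fromCols (topVec hk U) W * fromRows (topVec hk U)ᵀ Wᵀ = 1 := by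
    rw [fromCols_mul_fromRows_eq_one_comm e, fromRows_mul_fromCols, transpose_topVec_mul, hW.1,
      hW.2, hW', fromBlocks_one]
  rw [fromCols_mul_fromRows, topVec_mul_transpose] at hcols
  rw [spectralProj_compl]
  exact eq_sub_of_add_eq' hcols

theorem rep_mul_transpose (A : Matrix (Fin N) (Fin N) ℝ) {σ : Fin N → ℝ} (hσ : ∀ j, 0 ≤ σ j) :
    rep hk A U σ * (rep hk A U σ)ᵀ = invSqrtDeg A *
      spectralHom U ((Set.range (Fin.castLE hk)).indicator σ) * invSqrtDeg A := by
  have hsqrt : diagonal (topVal hk σ) =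
      (diagonal fun j => √(topVal hk σ j)) * diagonal fun j => √(topVal hk σ j) := by
    rw [diagonal_mul_diagonal]
    exact congrArg diagonal (funext fun j => (Real.mul_self_sqrt (hσ _)).symm)
  rw [← rankApprox_eq_spectralHom, rankApprox, hsqrt, rep]
  simp only [transpose_mul, diagonal_transpose, invSqrtDeg, Matrix.mul_assoc]

theorem IsSVD.exists_unitary {M V : Matrix (Fin N) (Fin N) ℝ} {σ : Fin N → ℝ} (h : IsSVD M V σ) :
    ∃ U : unitary (Matrix (Fin N) (Fin N) ℝ), ↑U = V ∧ M = spectralHom U σ := by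
  have hV : star V * V = 1 := h.orthonormal
  exact ⟨⟨V, Unitary.mem_iff.2 ⟨hV, mul_eq_one_comm.1 hV⟩⟩, rfl, h.decomp⟩

end Gram

section InvSqrt

variable {t : ℝ}

theorem inv_sqrt_one_add_le_one (ht : 0 ≤ t) : (√(1 + t))⁻¹ ≤ 1 :=
  inv_le_one_of_one_le₀ (Real.one_le_sqrt.2 (by linarith))

theorem one_sub_inv_sqrt_one_add_le (ht : 0 ≤ t) : 1 - (√(1 + t))⁻¹ ≤ t := by
  have hsqrt : √(1 + t) ≤ 1 + t := Real.sqrt_le_self_iff.2 (Or.inr (by linarith))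
  have hinv : (1 + t)⁻¹ ≤ (√(1 + t))⁻¹ := inv_anti₀ (by positivity) hsqrt
  have hbern : 1 - t ≤ (1 + t)⁻¹ := by
    rw [← one_div, le_div_iff₀ (by linarith)]
    nlinarith
  linarith

theorem abs_inv_sqrt_one_add_sub_one_add_le (ht : 0 ≤ t) :
    |(√(1 + t))⁻¹ - 1 + t / 2| ≤ t ^ 2 := by
  set u := √(1 + t)
  have hu : 1 ≤ u := Real.one_le_sqrt.2 (by linarith)
  have htu : t = (u - 1) * (u + 1) := by linarith [Real.sq_sqrt (show 0 ≤ 1 + t by linarith)]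
  have hfactor : u⁻¹ - 1 + t / 2 = (u - 1) ^ 2 * ((1 + 2 * u⁻¹) / 2) := by
    rw [htu]; field_simp; ring
  have hinv : u⁻¹ ≤ 1 := inv_sqrt_one_add_le_one ht
  rw [hfactor, abs_of_nonneg (by positivity), htu, mul_pow]
  gcongr
  nlinarith

end InvSqrt

section Graph

open Matrix

variable {N : ℕ} {A : Matrix (Fin N) (Fin N) ℝ} {l : Fin N → ℝ} {δ : ℝ}

theorem invSqrtDeg_eq_one (hdeg : ∀ x, degree A x = 1) : invSqrtDeg A = 1 := by
  simp [invSqrtDeg, hdeg]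

theorem normAdj_eq_self (hdeg : ∀ x, degree A x = 1) : normAdj A = A := by
  rw [normAdj, invSqrtDeg_eq_one hdeg, Matrix.one_mul, Matrix.mul_one]

theorem norm_le_one_of_degree_eq_one (hA : A.IsSymm) (h0 : ∀ x y, 0 ≤ A x y)
    (hdeg : ∀ x, degree A x = 1) : ‖A‖ ≤ 1 :=
  l2_opNorm_le_one_of_mem_doublyStochastic <| mem_doublyStochastic_iff_sum.2
    ⟨h0, hdeg, fun y => (Finset.sum_congr rfl fun x _ => hA.apply y x).trans (hdeg y)⟩

theorem norm_vecMulVec {m n : Type*} [Fintype m] [Fintype n] [DecidableEq n] (x : m → ℝ)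
    (y : n → ℝ) : ‖vecMulVec x y‖ = ‖WithLp.toLp 2 x‖ * ‖WithLp.toLp 2 y‖ := by
  have hrankOne := InnerProductSpace.symm_toEuclideanLin_rankOne (𝕜 := ℝ) (WithLp.toLp 2 x)
    (WithLp.toLp 2 y)
  rw [LinearEquiv.symm_apply_eq, star_trivial] at hrankOne
  rw [l2_opNorm_def, ← InnerProductSpace.norm_rankOne (𝕜 := ℝ)]
  exact congrArg norm (ContinuousLinearMap.coe_injective hrankOne.symm)

theorem norm_toLp_le_one_of_mem_stdSimplex (hl : l ∈ stdSimplex ℝ (Fin N)) :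
    ‖WithLp.toLp 2 l‖ ≤ 1 := by
  rw [← sq_le_one_iff₀ (norm_nonneg _), EuclideanSpace.real_norm_sq_eq, ← hl.2]
  exact Finset.sum_le_sum fun x _ =>
    pow_le_of_le_one (hl.1 x) (mem_Icc_of_mem_stdSimplex hl x).2 two_ne_zero

theorem norm_smul_vecMulVec_self_le (hl : l ∈ stdSimplex ℝ (Fin N)) (hδ : 0 ≤ δ) :
    ‖δ • vecMulVec l l‖ ≤ δ := by
  have hl1 := norm_toLp_le_one_of_mem_stdSimplex hl
  rw [norm_smul, Real.norm_of_nonneg hδ]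
  exact mul_le_of_le_one_right hδ <|
    (norm_vecMulVec l l).trans_le (mul_le_one₀ hl1 (norm_nonneg _) hl1)

theorem norm_smul_diagonal_le (hl : l ∈ stdSimplex ℝ (Fin N)) (hδ : 0 ≤ δ) :
    ‖δ • diagonal l‖ ≤ δ := by
  rw [norm_smul, Real.norm_of_nonneg hδ]
  refine mul_le_of_le_one_right hδ (norm_diagonal_le zero_le_one fun x => ?_)
  rw [abs_of_nonneg (hl.1 x)]
  exact (mem_Icc_of_mem_stdSimplex hl x).2

variable (hdeg : ∀ x, degree A x = 1) (hl : l ∈ stdSimplex ℝ (Fin N))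
include hdeg hl

theorem invSqrtDeg_add_smul_vecMulVec (δ : ℝ) :
    invSqrtDeg (A + δ • vecMulVec l l) = diagonal fun x => (√(1 + δ * l x))⁻¹ := by
  have hdegree (x) : degree (A + δ • vecMulVec l l) x = 1 + δ * l x := by
    rw [← hdeg x]
    simp [degree, Finset.sum_add_distrib, vecMulVec_apply, ← Finset.mul_sum, hl.2]
  simp only [invSqrtDeg, hdegree]

theorem norm_invSqrtDeg_le_one (hδ : 0 ≤ δ) : ‖invSqrtDeg (A + δ • vecMulVec l l)‖ ≤ 1 := by
  rw [invSqrtDeg_add_smul_vecMulVec hdeg hl]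
  refine norm_diagonal_le zero_le_one fun x => ?_
  rw [abs_of_nonneg (by positivity)]
  exact inv_sqrt_one_add_le_one (mul_nonneg hδ (hl.1 x))

theorem norm_invSqrtDeg_sub_one_le (hδ : 0 ≤ δ) :
    ‖invSqrtDeg (A + δ • vecMulVec l l) - 1‖ ≤ δ := by
  rw [invSqrtDeg_add_smul_vecMulVec hdeg hl, ← diagonal_one, diagonal_sub]
  refine norm_diagonal_le hδ fun x => ?_
  have hx : 0 ≤ δ * l x := mul_nonneg hδ (hl.1 x)
  rw [abs_sub_comm, abs_of_nonneg (sub_nonneg.2 (inv_sqrt_one_add_le_one hx))]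
  exact (one_sub_inv_sqrt_one_add_le hx).trans
    (mul_le_of_le_one_right hδ (mem_Icc_of_mem_stdSimplex hl x).2)

theorem norm_invSqrtDeg_sub_one_add_le (hδ : 0 ≤ δ) :
    ‖invSqrtDeg (A + δ • vecMulVec l l) - 1 + (δ / 2) • diagonal l‖ ≤ δ ^ 2 := by
  rw [invSqrtDeg_add_smul_vecMulVec hdeg hl, ← diagonal_one, diagonal_sub, ← diagonal_smul,
    diagonal_add]
  refine norm_diagonal_le (sq_nonneg δ) fun x => ?_
  have hx : 0 ≤ δ * l x := mul_nonneg hδ (hl.1 x)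
  have hxδ : δ * l x ≤ δ := mul_le_of_le_one_right hδ (mem_Icc_of_mem_stdSimplex hl x).2
  rw [Pi.smul_apply, smul_eq_mul, div_mul_eq_mul_div]
  exact (abs_inv_sqrt_one_add_sub_one_add_le hx).trans (by gcongr)

end Graph

section GramPerturbation

open Matrix

variable {N : ℕ} {A : Matrix (Fin N) (Fin N) ℝ} {l σ σ' : Fin N → ℝ} {δ b g : ℝ}
  {U U' : unitary (Matrix (Fin N) (Fin N) ℝ)} {s : Set (Fin N)}

/-- The derivative at `δ = 0` of the Gram matrix `Z(δ) Z(δ)ᵀ` of the spectral representation that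
keeps the eigenvalues in `s`, for a graph whose other eigenvalues vanish. -/
def gramDeriv (U : unitary (Matrix (Fin N) (Fin N) ℝ)) (s : Set (Fin N)) (σ l : Fin N → ℝ) :
    Matrix (Fin N) (Fin N) ℝ :=
  truncate (spectralProj U sᶜ) (vecMulVec l l) -
    (diagonal l * spectralHom U (s.indicator σ) + spectralHom U (s.indicator σ) * diagonal l)

theorem smul_gramDeriv (δ : ℝ) : δ • gramDeriv U s σ l =
    truncate (spectralProj U sᶜ) (δ • vecMulVec l l) - 2 * ((δ / 2) • diagonal l *
      spectralHom U (s.indicator σ) + spectralHom U (s.indicator σ) * (δ / 2) • diagonal l) := by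
  simp only [gramDeriv, truncate, two_mul, smul_mul_assoc, mul_smul_comm]
  module

variable (hdeg : ∀ x, degree A x = 1) (hU : IsSVD (normAdj A) U σ)
include hdeg hU

theorem eq_spectralHom : A = spectralHom U σ :=
  (normAdj_eq_self hdeg).symm.trans hU.decomp

theorem norm_spectralHom_le_one (h0 : ∀ x y, 0 ≤ A x y) : ‖spectralHom U σ‖ ≤ 1 := by
  have hsymm : A.IsSymm := eq_spectralHom hdeg hU ▸ (IsSelfAdjoint.all σ).map (spectralHom U)
  exact eq_spectralHom hdeg hU ▸ norm_le_one_of_degree_eq_one hsymm h0 hdeg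

theorem normAdj_eq_spectralHom
    (hU' : IsSVD (normAdj (A + δ • vecMulVec l l)) U' σ') :
    invSqrtDeg (A + δ • vecMulVec l l) * (spectralHom U σ + δ • vecMulVec l l) *
      invSqrtDeg (A + δ • vecMulVec l l) = spectralHom U' σ' := by
  rw [← eq_spectralHom hdeg hU]
  exact hU'.decomp

variable (h0 : ∀ x y, 0 ≤ A x y) (hl : l ∈ stdSimplex ℝ (Fin N)) (hδ : 0 ≤ δ)
  (hU' : IsSVD (normAdj (A + δ • vecMulVec l l)) U' σ')
include h0 hl hδ hU'

theorem norm_spectralHom_sub_le : ‖spectralHom U' σ' - spectralHom U σ‖ ≤ 3 * δ := by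
  rw [← normAdj_eq_spectralHom hdeg hU hU']
  exact norm_sandwich_add_sub_le norm_one_le (norm_invSqrtDeg_le_one hdeg hl hδ)
    (norm_invSqrtDeg_sub_one_le hdeg hl hδ) (norm_spectralHom_le_one hdeg hU h0)
    (norm_smul_vecMulVec_self_le hl hδ)

variable (hgap : HasGap σ s b g) (hδg : 6 * δ ≤ g)
include hgap hδg

theorem norm_spectralProj_compl_mul_le : ‖spectralProj U' sᶜ * spectralProj U s‖ ≤ 6 / g * δ :=
  (hgap.norm_spectralProj_compl_mul_le hU.antitone hU'.antitone hU'.nonneg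
    (norm_spectralHom_sub_le hdeg hU h0 hl hδ hU') (by linarith)).trans_eq (by ring)

theorem norm_spectralProj_compl_sub_compl_le :
    ‖spectralProj U' sᶜ - spectralProj U sᶜ‖ ≤ 2 * (6 / g) * δ :=
  (norm_spectralProj_compl_sub_le U U'
    (hgap.norm_spectralProj_compl_mul_le hU.antitone hU'.antitone hU'.nonneg
      (norm_spectralHom_sub_le hdeg hU h0 hl hδ hU') (by linarith))
    (hgap.norm_spectralProj_compl_mul_le' hU.antitone hU'.antitone hU.nonneg
      (norm_spectralHom_sub_le hdeg hU h0 hl hδ hU') (by linarith))).trans_eq (by ring)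

theorem norm_gram_sub_le :
    ‖invSqrtDeg (A + δ • vecMulVec l l) * spectralHom U' (s.indicator σ') *
        invSqrtDeg (A + δ • vecMulVec l l) - spectralHom U (s.indicator σ)‖
      ≤ (8 + 4 * (6 / g)) * δ := by
  have hnorm := norm_spectralHom_le_one hdeg hU h0
  have htrunc : ‖truncate (spectralProj U sᶜ) (spectralHom U σ)‖ ≤ 1 := by
    rw [truncate_spectralHom]
    exact (norm_spectralHom_indicator_le U).trans hnorm
  rw [← truncate_spectralHom U', ← truncate_spectralHom U, ← normAdj_eq_spectralHom hdeg hU hU']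
  exact norm_sandwich_truncate_sub_le norm_one_le (norm_invSqrtDeg_le_one hdeg hl hδ)
    (norm_invSqrtDeg_sub_one_le hdeg hl hδ) hnorm htrunc
    (norm_smul_vecMulVec_self_le hl hδ) (norm_spectralProj_le U sᶜ) (norm_spectralProj_le U' sᶜ)
    (norm_spectralProj_compl_sub_compl_le hdeg hU h0 hl hδ hU' hgap hδg)

theorem norm_gram_sub_sub_smul_gramDeriv_le :
    ‖invSqrtDeg (A + δ • vecMulVec l l) * spectralHom U' (s.indicator σ') *
        invSqrtDeg (A + δ • vecMulVec l l) - spectralHom U (s.indicator σ) -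
        δ • gramDeriv U s σ l‖
      ≤ 2 * b + (21 + 8 * (6 / g) + (6 / g) ^ 2) * δ ^ 2 := by
  have hx : ‖spectralHom U (s.indicator σ)‖ ≤ 1 :=
    (norm_spectralHom_indicator_le U).trans (norm_spectralHom_le_one hdeg hU h0)
  have hsplit : spectralHom U σ =
      spectralHom U (s.indicator σ) + spectralHom U (sᶜ.indicator σ) := by
    rw [← map_add, Set.indicator_self_add_compl]
  have hqx : spectralProj U sᶜ * spectralHom U (s.indicator σ) = 0 := by
    rw [spectralProj_mul_spectralHom, Set.indicator_indicator, Set.compl_inter_self,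
      Set.indicator_empty]
    exact map_zero _
  have hq'x := norm_spectralProj_mul_spectralHom_mul_le U U'
    (norm_spectralProj_compl_mul_le hdeg hU h0 hl hδ hU' hgap hδg) hx
  rw [one_mul] at hq'x
  rw [← truncate_spectralHom U', ← normAdj_eq_spectralHom hdeg hU hU', hsplit, smul_gramDeriv]
  exact norm_sandwich_truncate_sub_sub_le norm_one_le (norm_invSqrtDeg_le_one hdeg hl hδ)
    (norm_invSqrtDeg_sub_one_le hdeg hl hδ) (norm_invSqrtDeg_sub_one_add_le hdeg hl hδ)
    (norm_smul_diagonal_le hl (by positivity)) hx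
    (hgap.norm_spectralHom_indicator_compl_le hU.nonneg U) (norm_smul_vecMulVec_self_le hl hδ)
    (norm_spectralProj_le U sᶜ) (norm_spectralProj_le U' sᶜ)
    (norm_spectralProj_compl_sub_compl_le hdeg hU h0 hl hδ hU' hgap hδg)
    hqx ((commute_spectralProj_spectralHom U sᶜ _).eq.symm.trans hqx) hq'x

end GramPerturbation

section GramDeriv

open Matrix

variable {N : ℕ} (U : unitary (Matrix (Fin N) (Fin N) ℝ)) (s : Set (Fin N)) (σ l : Fin N → ℝ)

theorem rank_spectralHom_indicator_le :
    (spectralHom U (s.indicator σ)).rank ≤ (spectralProj U s).rank := by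
  rw [← spectralProj_mul_spectralHom]
  exact rank_mul_le_left _ _

theorem gramDeriv_eq : gramDeriv U s σ l =
    spectralProj U s * vecMulVec l l + spectralProj U sᶜ * vecMulVec l l * spectralProj U s -
      (diagonal l * spectralHom U (s.indicator σ) +
        spectralHom U (s.indicator σ) * diagonal l) := by
  rw [gramDeriv, truncate, spectralProj_compl]
  noncomm_ring

theorem rank_gramDeriv_le : (gramDeriv U s σ l).rank ≤ 4 * (spectralProj U s).rank := by
  have hx := rank_spectralHom_indicator_le U s σ
  rw [gramDeriv_eq]
  grw [rank_sub_le, rank_add_le, rank_add_le, rank_mul_le_left, rank_mul_le_right,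
    rank_mul_le_right, rank_mul_le_left, hx]
  omega

variable {s}

theorem trace_mul_transpose_of_isSymm {n R : Type*} [Fintype n] [CommRing R] {Y : Matrix n n R}
    (hY : Y.IsSymm) (M : Matrix n n R) : (Y * Mᵀ).trace = (Y * M).trace := by
  rw [← trace_transpose, transpose_mul, transpose_transpose, hY, trace_mul_comm]

theorem isSymm_spectralHom (f : Fin N → ℝ) : (spectralHom U f).IsSymm :=
  (IsSelfAdjoint.all f).map (spectralHom U)

theorem trace_mul_gramDeriv {Y : Matrix (Fin N) (Fin N) ℝ} (hY : Y.IsSymm) :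
    (Y * gramDeriv U s σ l).trace =
      (Y * (spectralProj U s * vecMulVec l l * (1 + spectralProj U sᶜ) -
        (2 : ℝ) • (spectralHom U (s.indicator σ) * diagonal l))).trace := by
  set x := spectralHom U (s.indicator σ)
  set p := spectralProj U s
  set q := spectralProj U sᶜ
  have hlx : (diagonal l * x)ᵀ = x * diagonal l := by
    rw [transpose_mul, diagonal_transpose, isSymm_spectralHom]
  have hqp : (q * vecMulVec l l * p)ᵀ = p * vecMulVec l l * q := by
    rw [transpose_mul, transpose_mul, transpose_vecMulVec, Matrix.mul_assoc]
    exact congrArg₂ _ (isSymm_spectralHom U _) (congrArg _ (isSymm_spectralHom U _))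
  have hexpand : p * vecMulVec l l * (1 + q) - (2 : ℝ) • (x * diagonal l) =
      p * vecMulVec l l + p * vecMulVec l l * q - (x * diagonal l + x * diagonal l) := by
    rw [two_smul]; noncomm_ring
  rw [gramDeriv_eq, hexpand]
  simp only [Matrix.mul_sub, Matrix.mul_add, trace_sub, trace_add]
  rw [← trace_mul_transpose_of_isSymm hY (diagonal l * x), hlx,
    ← trace_mul_transpose_of_isSymm hY (q * vecMulVec l l * p), hqp]

end GramDeriv

section KMeans

open Matrix

theorem sum_parts_eq {α M : Type*} [DecidableEq α] [AddCommMonoid M] {t : Finset α}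
    (P : Finpartition t) (F : Finset α → α → M) :
    ∑ s ∈ P.parts, ∑ i ∈ s, F s i = ∑ i ∈ t, F (P.part i) i :=
  calc _ = ∑ s ∈ P.parts, ∑ i ∈ s, F (P.part i) i :=
        Finset.sum_congr rfl fun s hs => Finset.sum_congr rfl fun i hi => by
          rw [P.part_eq_of_mem hs hi]
    _ = ∑ i ∈ P.parts.biUnion id, F (P.part i) i := (Finset.sum_biUnion P.disjoint).symm
    _ = ∑ i ∈ t, F (P.part i) i := by rw [P.biUnion_parts]

theorem sum_norm_sq_rows_eq_trace {m n : Type*} [Fintype m] [Fintype n]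
    {S : Matrix m m ℝ} (hS : IsStarProjection S) (Z : Matrix m n ℝ) :
    ∑ i, ‖WithLp.toLp 2 ((S * Z) i)‖ ^ 2 = (S * (Z * Zᵀ)).trace := by
  have hsymm : Sᵀ = S := hS.isSelfAdjoint
  have hgram : (S * (Z * Zᵀ)).trace = (S * Z * (S * Z)ᵀ).trace := by
    rw [transpose_mul, hsymm, ← Matrix.mul_assoc (S * Z), trace_mul_comm _ S]
    simp only [← Matrix.mul_assoc, hS.isIdempotentElem.eq]
  rw [hgram]
  simp only [EuclideanSpace.real_norm_sq_eq]
  simp only [trace, diag_apply, mul_apply (M := S * Z), transpose_apply, sq]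

variable {N k : ℕ} (cls : Finpartition (Finset.univ : Finset (Fin N)))

theorem card_part_pos (x : Fin N) : 0 < ((cls.part x).card : ℝ) :=
  mod_cast (cls.part_nonempty.2 (Finset.mem_univ x)).card_pos

theorem mem_part_iff {x y : Fin N} : y ∈ cls.part x ↔ cls.part y = cls.part x :=
  cls.mem_part_iff_part_eq_part (Finset.mem_univ _) (Finset.mem_univ _)

theorem classAvg_mul_apply {m : Type*} (M : Matrix (Fin N) m ℝ) (x : Fin N) (j : m) :
    (classAvg cls * M) x j = ((cls.part x).card : ℝ)⁻¹ * ∑ i ∈ cls.part x, M i j := by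
  simp [mul_apply, classAvg, ite_mul, Finset.mul_sum, Finset.sum_ite_mem]

theorem classAvg_mul_eq_self {m : Type*} {M : Matrix (Fin N) m ℝ}
    (hM : ∀ x, ∀ y ∈ cls.part x, M y = M x) : classAvg cls * M = M := by
  ext x j
  rw [classAvg_mul_apply, Finset.sum_congr rfl fun y hy => congrFun (hM x y hy) j,
    Finset.sum_const, nsmul_eq_mul, inv_mul_cancel_left₀ (card_part_pos cls x).ne']

theorem isStarProjection_classAvg : IsStarProjection (classAvg cls) where
  isIdempotentElem := classAvg_mul_eq_self cls fun x y hy => by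
    ext j
    simp only [classAvg, of_apply, (mem_part_iff cls).1 hy]
  isSelfAdjoint := by
    ext x y
    simp only [star_apply, star_trivial, classAvg, of_apply, mem_part_iff,
      eq_comm (a := cls.part x)]
    split_ifs with h
    · rw [h]
    · rfl

/-- The matrix that replaces every row by the mean of all rows; for `N = 0` it is the empty
matrix. -/
def meanAvg (N : ℕ) : Matrix (Fin N) (Fin N) ℝ := of fun _ _ => (N : ℝ)⁻¹

theorem isStarProjection_meanAvg : IsStarProjection (meanAvg N) where
  isIdempotentElem := by
    ext x y
    have : (N : ℝ) ≠ 0 := mod_cast x.pos.ne'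
    simp [meanAvg, mul_apply, this]
  isSelfAdjoint := rfl

/-- The projection `I - H_Π` onto the deviations from the class means; its trace against the Gram
matrix `Z Zᵀ` is `M_intra`. -/
def withinProj : Matrix (Fin N) (Fin N) ℝ := 1 - classAvg cls

/-- The projection `H_Π - 𝟏 𝟏ᵀ / N` onto the deviations of the class means from the overall mean;
its trace against the Gram matrix `Z Zᵀ` is `M_inter`. -/
def betweenProj : Matrix (Fin N) (Fin N) ℝ := classAvg cls - meanAvg N

theorem isStarProjection_withinProj : IsStarProjection (withinProj cls) :=
  (isStarProjection_classAvg cls).one_sub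

theorem isStarProjection_betweenProj : IsStarProjection (betweenProj cls) :=
  isStarProjection_meanAvg.sub_of_mul_eq_right (isStarProjection_classAvg cls)
    (classAvg_mul_eq_self cls fun _ _ _ => rfl)

theorem intra_eq_trace (Z : Matrix (Fin N) (Fin k) ℝ) :
    intra cls Z = (withinProj cls * (Z * Zᵀ)).trace := by
  rw [← sum_norm_sq_rows_eq_trace (isStarProjection_withinProj cls), intra,
    sum_parts_eq cls fun s i => ‖WithLp.toLp 2 fun j => Z i j - center Z s j‖ ^ 2]
  refine Finset.sum_congr rfl fun i _ => ?_
  congr 3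
  ext j
  rw [withinProj, Matrix.sub_mul, Matrix.one_mul, Matrix.sub_apply, classAvg_mul_apply, center]

theorem inter_eq_trace (Z : Matrix (Fin N) (Fin k) ℝ) :
    inter cls Z = (betweenProj cls * (Z * Zᵀ)).trace := by
  have hsum : inter cls Z = ∑ s ∈ cls.parts, ∑ _i ∈ s,
      ‖WithLp.toLp 2 fun j => center Z s j - center Z Finset.univ j‖ ^ 2 := by
    simp [inter]
  rw [hsum, ← sum_norm_sq_rows_eq_trace (isStarProjection_betweenProj cls),
    sum_parts_eq cls fun s _ => ‖WithLp.toLp 2 fun j => center Z s j - center Z Finset.univ j‖ ^ 2]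
  refine Finset.sum_congr rfl fun i _ => ?_
  congr 3
  ext j
  rw [betweenProj, Matrix.sub_mul, Matrix.sub_apply, classAvg_mul_apply, center, center, mul_apply]
  simp [meanAvg, Finset.mul_sum]

theorem upsilon_eq (Z : Matrix (Fin N) (Fin k) ℝ) :
    upsilon cls Z = eta2 cls Z • betweenProj cls - withinProj cls := by
  ext x y
  simp [upsilon, betweenProj, withinProj, meanAvg]
  ring

theorem intra_nonneg (Z : Matrix (Fin N) (Fin k) ℝ) : 0 ≤ intra cls Z :=
  Finset.sum_nonneg fun _ _ => Finset.sum_nonneg fun _ _ => sq_nonneg _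

variable {cls} {Z : Matrix (Fin N) (Fin k) ℝ} {x y : Fin N}

theorem upsilon_pos_of_mem_part (hZ : 0 < inter cls Z) (hxy : x ≠ y) (h : y ∈ cls.part x) :
    0 < upsilon cls Z x y := by
  have hη : 0 ≤ eta2 cls Z := div_nonneg (intra_nonneg cls Z) hZ.le
  have hcard := card_part_pos cls x
  have hmean : (N : ℝ)⁻¹ ≤ ((cls.part x).card : ℝ)⁻¹ :=
    inv_anti₀ hcard (mod_cast (Finset.card_le_univ _).trans_eq (Fintype.card_fin N))
  have hentry : upsilon cls Z x y = ((cls.part x).card : ℝ)⁻¹ +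
      eta2 cls Z * (((cls.part x).card : ℝ)⁻¹ - (N : ℝ)⁻¹) := by
    simp only [upsilon, classAvg, Matrix.sub_apply, Matrix.smul_apply, of_apply, if_pos h,
      one_apply_ne hxy, smul_eq_mul]
    ring
  rw [hentry]
  exact add_pos_of_pos_of_nonneg (inv_pos.2 hcard) (mul_nonneg hη (sub_nonneg.2 hmean))

theorem upsilon_neg_of_notMem_part (hZ : 0 < inter cls Z) (hZ' : 0 < intra cls Z)
    (h : y ∉ cls.part x) : upsilon cls Z x y < 0 := by
  have hxy : x ≠ y := fun hxy => h (hxy ▸ cls.mem_part_self.2 (Finset.mem_univ _))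
  have hN : (0 : ℝ) < N := mod_cast x.pos
  have hentry : upsilon cls Z x y = -(eta2 cls Z / N) := by
    simp only [upsilon, classAvg, Matrix.sub_apply, Matrix.smul_apply, of_apply, if_neg h,
      one_apply_ne hxy, smul_eq_mul]
    ring
  rw [hentry, neg_neg_iff_pos]
  exact div_pos (div_pos hZ' hZ) hN

theorem mainCoeff_eq {l σ : Fin N → ℝ} (hk : k ≤ N) (U : unitary (Matrix (Fin N) (Fin N) ℝ))
    {W : Matrix (Fin N) (Fin (N - k)) ℝ} (hW : IsNullBasis (topVec hk U) W) :
    mainCoeff hk cls Z l U σ W =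
      (intra cls Z / inter cls Z *
          (betweenProj cls * gramDeriv U (Set.range (Fin.castLE hk)) σ l).trace -
        (withinProj cls * gramDeriv U (Set.range (Fin.castLE hk)) σ l).trace) / inter cls Z := by
  have hsymm : (upsilon cls Z).IsSymm := by
    rw [upsilon_eq]
    exact IsSymm.sub (IsSymm.smul (isStarProjection_betweenProj cls).isSelfAdjoint _)
      (isStarProjection_withinProj cls).isSelfAdjoint
  rw [mainCoeff, mul_transpose_eq_spectralProj hk U hW, topVec_mul_transpose,
    rankApprox_eq_spectralHom, ← trace_mul_gramDeriv U σ l hsymm, upsilon_eq]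
  simp only [Matrix.sub_mul, Matrix.smul_mul, trace_sub, trace_smul, eta1, eta2, smul_eq_mul]
  ring

end KMeans

section KernelGraph

variable {Xbar : Type*} [MeasurableSpace Xbar] {N : ℕ} {P Pl : Measure Xbar}
  {T : Kernel Xbar (Fin N)} {ηu : ℝ}

theorem labelVec_mem_stdSimplex [IsProbabilityMeasure Pl] [IsMarkovKernel T] :
    labelVec Pl T ∈ stdSimplex ℝ (Fin N) := by
  refine ⟨fun x => integral_nonneg fun _ => measureReal_nonneg, ?_⟩
  have hint (x : Fin N) : Integrable (fun xb => (T xb).real {x}) Pl :=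
    Integrable.of_bound (C := 1)
      (T.measurable_coe (measurableSet_singleton x)).ennreal_toReal.aestronglyMeasurable <|
      .of_forall fun _ => (Real.norm_of_nonneg measureReal_nonneg).trans_le measureReal_le_one
  simp only [labelVec]
  rw [← integral_finsetSum _ fun x _ => hint x]
  simp

theorem adj_eq (δ : ℝ) : adj ηu P Pl T δ =
    adj ηu P Pl T 0 + δ • Matrix.vecMulVec (labelVec Pl T) (labelVec Pl T) := by
  simp [adj]

theorem adj_zero_nonneg (hdeg : ∀ x, degree (adj ηu P Pl T 0) x = 1) (x y : Fin N) :
    0 ≤ adj ηu P Pl T 0 x y := by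
  have hA (x y) : 0 ≤ selfSupAdj P T x y :=
    integral_nonneg fun _ => mul_nonneg measureReal_nonneg measureReal_nonneg
  have hrow : ηu * ∑ y, selfSupAdj P T x y = 1 := by
    rw [← hdeg x]; simp [degree, adj, Finset.mul_sum]
  have hηu : 0 < ηu :=
    pos_of_mul_pos_left (hrow ▸ one_pos) (Finset.sum_nonneg fun y _ => hA x y)
  simpa [adj] using mul_nonneg hηu.le (hA x y)

end KernelGraph

section Quotient

variable {i₀ i₁ n₀ n₁ p q x y K B c d e : ℝ}

theorem div_sub_div_sub_mul_eq (hn₀ : n₀ ≠ 0) (hn₁ : n₁ ≠ 0) (i₀ i₁ p q t : ℝ) :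
    i₀ / n₀ - i₁ / n₁ - t * ((i₀ / n₀ * q - p) / n₀) =
      (i₀ * (n₁ - n₀) - n₀ * (i₁ - i₀)) * (n₀ - n₁) * (n₀⁻¹ * n₀⁻¹ * n₁⁻¹) +
        (i₀ * (n₁ - n₀ - t * q) - n₀ * (i₁ - i₀ - t * p)) * (n₀⁻¹ * n₀⁻¹) := by
  field_simp
  ring

theorem abs_mul_sub_mul_le (hi : |i₀| ≤ K) (hn : |n₀| ≤ K) (hx : |x| ≤ c) (hy : |y| ≤ c) :
    |i₀ * x - n₀ * y| ≤ 2 * K * c := by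
  have hK : 0 ≤ K := (abs_nonneg _).trans hi
  calc |i₀ * x - n₀ * y| ≤ |i₀ * x| + |n₀ * y| := abs_sub _ _
    _ = |i₀| * |x| + |n₀| * |y| := by rw [abs_mul, abs_mul]
    _ ≤ K * c + K * c := by gcongr
    _ = 2 * K * c := by ring

theorem pos_and_inv_le_of_abs_sub_le (hn₀ : 0 < n₀) (hB : n₀⁻¹ ≤ B) (hdn : |n₁ - n₀| ≤ d)
    (hd : 2 * B * d ≤ 1) : 0 < n₁ ∧ n₁⁻¹ ≤ 2 * B := by
  have hB0 : 0 < B := (inv_pos.2 hn₀).trans_le hB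
  have hn₁ : (2 * B)⁻¹ ≤ n₁ := by
    have hBn : B⁻¹ ≤ n₀ := inv_le_of_inv_le₀ hn₀ hB
    have hdB : d ≤ (2 * B)⁻¹ := by rwa [← one_div, le_div_iff₀' (by positivity)]
    rw [mul_inv] at hdB ⊢
    linarith [(abs_le.1 hdn).1]
  exact ⟨lt_of_lt_of_le (by positivity) hn₁, inv_le_of_inv_le₀ (by positivity) hn₁⟩

theorem abs_div_sub_div_sub_mul_le {t : ℝ} (hn₀ : 0 < n₀) (hB : n₀⁻¹ ≤ B) (hi : |i₀| ≤ K)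
    (hn : |n₀| ≤ K) (hd : 2 * B * d ≤ 1) (hdi : |i₁ - i₀| ≤ d) (hdn : |n₁ - n₀| ≤ d)
    (hp : |i₁ - i₀ - t * p| ≤ e) (hq : |n₁ - n₀ - t * q| ≤ e) :
    |i₀ / n₀ - i₁ / n₁ - t * ((i₀ / n₀ * q - p) / n₀)|
      ≤ 4 * K * B ^ 3 * d ^ 2 + 2 * K * B ^ 2 * e := by
  obtain ⟨hn₁, hB₁⟩ := pos_and_inv_le_of_abs_sub_le hn₀ hB hdn hd
  have hK : 0 ≤ K := (abs_nonneg _).trans hi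
  have hB0 : 0 ≤ B := (inv_pos.2 hn₀).le.trans hB
  have hd0 : 0 ≤ d := (abs_nonneg _).trans hdi
  have he0 : 0 ≤ e := (abs_nonneg _).trans hp
  rw [div_sub_div_sub_mul_eq hn₀.ne' hn₁.ne']
  calc _ ≤ |i₀ * (n₁ - n₀) - n₀ * (i₁ - i₀)| * |n₀ - n₁| * (n₀⁻¹ * n₀⁻¹ * n₁⁻¹) +
        |i₀ * (n₁ - n₀ - t * q) - n₀ * (i₁ - i₀ - t * p)| * (n₀⁻¹ * n₀⁻¹) := by
        refine (abs_add_le _ _).trans_eq ?_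
        rw [abs_mul _ (n₀⁻¹ * n₀⁻¹ * n₁⁻¹), abs_mul _ (n₀⁻¹ * n₀⁻¹), abs_mul _ (n₀ - n₁),
          abs_of_pos (a := n₀⁻¹ * n₀⁻¹ * n₁⁻¹) (by positivity),
          abs_of_pos (a := n₀⁻¹ * n₀⁻¹) (by positivity)]
    _ ≤ 2 * K * d * d * (B * B * (2 * B)) + 2 * K * e * (B * B) := by
        gcongr
        · exact abs_mul_sub_mul_le hi hn hdn hdi
        · rwa [abs_sub_comm]
        · exact abs_mul_sub_mul_le hi hn hq hp
    _ = 4 * K * B ^ 3 * d ^ 2 + 2 * K * B ^ 2 * e := by ring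

end Quotient

section SingVal

variable {N k : ℕ} {σ : Fin N → ℝ} {a G : ℝ}

theorem singVal_nonneg (h0 : ∀ j, 0 ≤ σ j) (j : ℕ) : 0 ≤ singVal σ j := by
  unfold singVal
  split_ifs
  exacts [h0 _, le_rfl]

theorem singVal_le_one (h1 : ∀ j, σ j ≤ 1) (j : ℕ) : singVal σ j ≤ 1 := by
  unfold singVal
  split_ifs
  exacts [h1 _, zero_le_one]

theorem singVal_le_apply (hσ : Antitone σ) {i : Fin N} (hi : (i : ℕ) < k) (hk : k ≤ N) :
    singVal σ k ≤ σ i := by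
  rw [singVal, dif_pos ⟨by omega, hk⟩]
  exact hσ (Fin.le_def.2 (Nat.le_sub_one_of_lt hi))

theorem apply_le_singVal_succ (hσ : Antitone σ) {i : Fin N} (hi : k ≤ i) :
    σ i ≤ singVal σ (k + 1) := by
  rw [singVal, dif_pos ⟨by omega, by omega⟩]
  exact hσ (Fin.le_def.2 hi)

theorem mul_singVal_succ_le (h0 : ∀ j, 0 ≤ σ j) (hG : ENNReal.ofReal G ≤ spectralGap σ k) :
    G * singVal σ (k + 1) ≤ singVal σ k := by
  have hk := singVal_nonneg h0 k
  rcases (singVal_nonneg h0 (k + 1)).eq_or_lt with h | h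
  · rwa [← h, mul_zero]
  · rwa [spectralGap, ← ENNReal.ofReal_div_of_pos h,
      ENNReal.ofReal_le_ofReal_iff (by positivity), le_div_iff₀ h] at hG

theorem toReal_inv_spectralGap (h0 : ∀ j, 0 ≤ σ j) (hk : 0 < singVal σ k) :
    (spectralGap σ k)⁻¹.toReal = singVal σ (k + 1) / singVal σ k := by
  rw [spectralGap, ENNReal.inv_div (.inl ENNReal.ofReal_ne_top) (.inr (by simpa using hk)),
    ENNReal.toReal_div, ENNReal.toReal_ofReal (singVal_nonneg h0 _), ENNReal.toReal_ofReal hk.le]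

theorem singVal_succ_le_toReal_inv_spectralGap (h0 : ∀ j, 0 ≤ σ j) (h1 : ∀ j, σ j ≤ 1)
    (hk : 0 < singVal σ k) : singVal σ (k + 1) ≤ (spectralGap σ k)⁻¹.toReal := by
  rw [toReal_inv_spectralGap h0 hk, le_div_iff₀ hk]
  exact mul_le_of_le_one_right (singVal_nonneg h0 _) (singVal_le_one h1 k)

theorem apply_le_one {A : Matrix (Fin N) (Fin N) ℝ} {U : unitary (Matrix (Fin N) (Fin N) ℝ)}
    (hdeg : ∀ x, degree A x = 1) (hU : IsSVD (normAdj A) U σ) (h0 : ∀ x y, 0 ≤ A x y) (j : Fin N) :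
    σ j ≤ 1 :=
  calc σ j ≤ ‖σ j‖ := Real.le_norm_self _
    _ ≤ ‖σ‖ := norm_le_pi_norm σ j
    _ = ‖spectralHom U σ‖ := (norm_spectralHom U σ).symm
    _ ≤ 1 := norm_spectralHom_le_one hdeg hU h0

theorem hasGap_range_castLE (hk : k ≤ N) (hσ : Antitone σ) (h0 : ∀ j, 0 ≤ σ j) (ha : 0 < a)
    (hak : a ≤ singVal σ k) (hG : 1 < G) (hgap : ENNReal.ofReal G ≤ spectralGap σ k) :
    HasGap σ (Set.range (Fin.castLE hk)) (singVal σ (k + 1)) (a * (1 - 1 / G)) where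
  nonneg := singVal_nonneg h0 _
  pos := mul_pos ha (sub_pos.2 ((div_lt_one (one_pos.trans hG)).2 hG))
  add_le := by
    rintro _ ⟨j, rfl⟩
    have hratio : singVal σ (k + 1) ≤ singVal σ k * (1 / G) := by
      rw [mul_one_div, le_div_iff₀' (one_pos.trans hG)]
      exact mul_singVal_succ_le h0 hgap
    have hwidth : a * (1 - 1 / G) ≤ singVal σ k * (1 - 1 / G) :=
      mul_le_mul_of_nonneg_right hak (sub_nonneg.2 ((div_le_one (one_pos.trans hG)).2 hG.le))
    linarith [singVal_le_apply hσ (i := Fin.castLE hk j) j.is_lt hk]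
  le i hi := apply_le_singVal_succ hσ <| not_lt.1 fun h => hi ⟨⟨i, h⟩, rfl⟩

end SingVal

section KMeansPerturbation

open Matrix

variable {N k : ℕ} {hk : k ≤ N} {A S : Matrix (Fin N) (Fin N) ℝ} {l σ σ' : Fin N → ℝ}
  {δ b g B : ℝ} {U U' : unitary (Matrix (Fin N) (Fin N) ℝ)}

theorem rank_smul_gramDeriv_le (hk : k ≤ N) (U : unitary (Matrix (Fin N) (Fin N) ℝ))
    (σ l : Fin N → ℝ) (δ : ℝ) :
    (δ • gramDeriv U (Set.range (Fin.castLE hk)) σ l).rank ≤ 4 * k := by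
  have hrank : (spectralProj U (Set.range (Fin.castLE hk))).rank ≤ k := by
    rw [← topVec_mul_transpose]
    exact (rank_mul_transpose_self_le _).trans_eq (Fintype.card_fin k)
  rw [← Matrix.one_mul (gramDeriv _ _ _ _), ← smul_mul_assoc]
  grw [rank_mul_le_right, rank_gramDeriv_le, hrank]

theorem rank_gram_sub_le {m : Type*} [Fintype m] (Z Z' : Matrix m (Fin k) ℝ) :
    (Z' * Z'ᵀ - Z * Zᵀ).rank ≤ 2 * k := by
  grw [rank_sub_le, rank_mul_transpose_self_le, rank_mul_transpose_self_le, Fintype.card_fin]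
  omega

variable (hdeg : ∀ x, degree A x = 1) (hU : IsSVD (normAdj A) U σ)
include hdeg hU

theorem gram_rep_eq : rep hk A U σ * (rep hk A U σ)ᵀ =
    spectralHom U ((Set.range (Fin.castLE hk)).indicator σ) := by
  rw [rep_mul_transpose hk U A hU.nonneg, invSqrtDeg_eq_one hdeg, Matrix.one_mul, Matrix.mul_one]

variable (h0 : ∀ x y, 0 ≤ A x y)
include h0

theorem abs_trace_mul_gram_le (hS : ‖S‖ ≤ 1) :
    |(S * (rep hk A U σ * (rep hk A U σ)ᵀ)).trace| ≤ k := by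
  have hnorm : ‖rep hk A U σ * (rep hk A U σ)ᵀ‖ ≤ 1 := by
    rw [gram_rep_eq hdeg hU]
    exact (norm_spectralHom_indicator_le U).trans (norm_spectralHom_le_one hdeg hU h0)
  simpa only [Fintype.card_fin, mul_one, Real.norm_eq_abs] using
    norm_trace_mul_le hS (rank_mul_transpose_self_le _) hnorm

variable (hl : l ∈ stdSimplex ℝ (Fin N)) (hδ : 0 ≤ δ)
  (hU' : IsSVD (normAdj (A + δ • vecMulVec l l)) U' σ')
  (hgap : HasGap σ (Set.range (Fin.castLE hk)) b g) (hδg : 6 * δ ≤ g)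
include hl hδ hU' hgap hδg

theorem abs_trace_mul_gram_sub_le (hS : ‖S‖ ≤ 1) :
    |(S * (rep hk (A + δ • vecMulVec l l) U' σ' * (rep hk (A + δ • vecMulVec l l) U' σ')ᵀ)).trace -
        (S * (rep hk A U σ * (rep hk A U σ)ᵀ)).trace| ≤ 2 * k * (8 + 4 * (6 / g)) * δ := by
  have hnorm := norm_gram_sub_le hdeg hU h0 hl hδ hU' hgap hδg
  rw [← rep_mul_transpose hk U' _ hU'.nonneg, ← gram_rep_eq hdeg hU] at hnorm
  have htrace := norm_trace_mul_le hS (rank_gram_sub_le _ _) hnorm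
  rw [Matrix.mul_sub, trace_sub] at htrace
  exact htrace.trans_eq (by push_cast; ring)

theorem abs_trace_mul_gram_sub_sub_le (hS : ‖S‖ ≤ 1) :
    |(S * (rep hk (A + δ • vecMulVec l l) U' σ' * (rep hk (A + δ • vecMulVec l l) U' σ')ᵀ)).trace -
        (S * (rep hk A U σ * (rep hk A U σ)ᵀ)).trace -
        δ * (S * gramDeriv U (Set.range (Fin.castLE hk)) σ l).trace|
      ≤ 6 * k * (2 * b + (21 + 8 * (6 / g) + (6 / g) ^ 2) * δ ^ 2) := by
  have hnorm := norm_gram_sub_sub_smul_gramDeriv_le hdeg hU h0 hl hδ hU' hgap hδg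
  rw [← rep_mul_transpose hk U' _ hU'.nonneg, ← gram_rep_eq hdeg hU] at hnorm
  have hrank : (rep hk (A + δ • vecMulVec l l) U' σ' * (rep hk (A + δ • vecMulVec l l) U' σ')ᵀ -
      rep hk A U σ * (rep hk A U σ)ᵀ -
      δ • gramDeriv U (Set.range (Fin.castLE hk)) σ l).rank ≤ 6 * k := by
    grw [rank_sub_le, rank_gram_sub_le, rank_smul_gramDeriv_le]
    omega
  have htrace := norm_trace_mul_le hS hrank hnorm
  rw [Matrix.mul_sub, Matrix.mul_sub, trace_sub, trace_sub, mul_smul_comm, trace_smul,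
    smul_eq_mul] at htrace
  exact htrace.trans_eq (by push_cast; ring)

variable {cls : Finpartition (Finset.univ : Finset (Fin N))} (hpos : 0 < inter cls (rep hk A U σ))
  (hB : eta1 cls (rep hk A U σ) ≤ B) (hδB : 2 * B * (2 * k * (8 + 4 * (6 / g)) * δ) ≤ 1)
include hpos hB hδB

theorem inter_rep_pos : 0 < inter cls (rep hk (A + δ • vecMulVec l l) U' σ') := by
  refine (pos_and_inv_le_of_abs_sub_le hpos ((inv_eq_one_div _).trans_le hB) ?_ hδB).1
  rw [inter_eq_trace, inter_eq_trace]
  exact abs_trace_mul_gram_sub_le hdeg hU h0 hl hδ hU' hgap hδg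
    (isStarProjection_betweenProj cls).norm_le

theorem abs_kms_sub_kms_sub_mul_mainCoeff_le {W : Matrix (Fin N) (Fin (N - k)) ℝ}
    (hW : IsNullBasis (topVec hk U) W) :
    |kms cls (rep hk A U σ) - kms cls (rep hk (A + δ • vecMulVec l l) U' σ') -
        δ * mainCoeff hk cls (rep hk A U σ) l U σ W|
      ≤ 4 * k * B ^ 3 * (2 * k * (8 + 4 * (6 / g)) * δ) ^ 2 +
        2 * k * B ^ 2 * (6 * k * (2 * b + (21 + 8 * (6 / g) + (6 / g) ^ 2) * δ ^ 2)) := by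
  have hw : ‖withinProj cls‖ ≤ 1 := (isStarProjection_withinProj cls).norm_le
  have hb : ‖betweenProj cls‖ ≤ 1 := (isStarProjection_betweenProj cls).norm_le
  rw [mainCoeff_eq hk U hW]
  apply abs_div_sub_div_sub_mul_le hpos ((inv_eq_one_div _).trans_le hB) ?_ ?_ hδB
  all_goals simp only [intra_eq_trace, inter_eq_trace]
  · exact abs_trace_mul_gram_sub_le hdeg hU h0 hl hδ hU' hgap hδg hw
  · exact abs_trace_mul_gram_sub_le hdeg hU h0 hl hδ hU' hgap hδg hb
  · exact abs_trace_mul_gram_sub_sub_le hdeg hU h0 hl hδ hU' hgap hδg hw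
  · exact abs_trace_mul_gram_sub_sub_le hdeg hU h0 hl hδ hU' hgap hδg hb
  · exact abs_trace_mul_gram_le hdeg hU h0 hw
  · exact abs_trace_mul_gram_le hdeg hU h0 hb

end KMeansPerturbation

section UniformBound

variable {k : ℕ} {B E δ p q r b x : ℝ}

theorem mul_sq_add_mul_le (hp : 0 ≤ p) (hq : 0 ≤ q) (hr : 0 ≤ r) (hb : 0 ≤ b) (hbx : b ≤ x) :
    p * δ ^ 2 + q * (2 * b + r * δ ^ 2) ≤ (p + q * (2 + r) + 1) * (x + δ ^ 2) := by
  have hx : 0 ≤ x := hb.trans hbx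
  calc p * δ ^ 2 + q * (2 * b + r * δ ^ 2) ≤ p * δ ^ 2 + q * (2 * x + r * δ ^ 2) := by gcongr
    _ ≤ p * δ ^ 2 + q * (2 * x + r * δ ^ 2) +
        (p * x + q * (2 * δ ^ 2 + r * x) + (x + δ ^ 2)) := le_add_of_nonneg_right (by positivity)
    _ = (p + q * (2 + r) + 1) * (x + δ ^ 2) := by ring

theorem mul_mul_le_one (hB : 0 < B) (hE : 0 ≤ E) (hδ : 0 ≤ δ) (hδB : δ ≤ 1 / (2 * B * (E + 1))) :
    2 * B * (E * δ) ≤ 1 := by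
  rw [le_div_iff₀ (by positivity)] at hδB
  linarith [mul_nonneg hB.le hδ]

end UniformBound

end SORL

end

theorem mainTheorem5_general (k : ℕ) (a G₀ B : ℝ) (ha : 0 < a) (hG₀ : 1 < G₀) (hB : 0 < B) :
    ∃ C δ₀ : ℝ, 0 < C ∧ 0 < δ₀ ∧
      ∀ (N : ℕ) (hk : k ≤ N) (A : Matrix (Fin N) (Fin N) ℝ) (l : Fin N → ℝ)
        (cls : Finpartition (Finset.univ : Finset (Fin N)))
        (V : Matrix (Fin N) (Fin N) ℝ) (σ : Fin N → ℝ) (W : Matrix (Fin N) (Fin (N - k)) ℝ),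
        (∀ x y, 0 ≤ A x y) → (∀ x, SORL.degree A x = 1) → l ∈ stdSimplex ℝ (Fin N) →
        SORL.IsSVD (SORL.normAdj A) V σ → SORL.IsNullBasis (SORL.topVec hk V) W →
        a ≤ SORL.singVal σ k → ENNReal.ofReal G₀ ≤ SORL.spectralGap σ k →
        0 < SORL.inter cls (SORL.rep hk A V σ) → SORL.eta1 cls (SORL.rep hk A V σ) ≤ B →
        (∀ x x', x ≠ x' → x' ∈ cls.part x → 0 < SORL.upsilon cls (SORL.rep hk A V σ) x x') ∧
        (∀ x x', x' ∉ cls.part x → 0 < SORL.intra cls (SORL.rep hk A V σ) →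
          SORL.upsilon cls (SORL.rep hk A V σ) x x' < 0) ∧
        ∀ δ : ℝ, 0 ≤ δ → δ ≤ δ₀ →
          ∀ (Vδ : Matrix (Fin N) (Fin N) ℝ) (σδ : Fin N → ℝ),
            SORL.IsSVD (SORL.normAdj (A + δ • Matrix.vecMulVec l l)) Vδ σδ →
            0 < SORL.inter cls (SORL.rep hk (A + δ • Matrix.vecMulVec l l) Vδ σδ) ∧
            |SORL.kms cls (SORL.rep hk A V σ) -
                SORL.kms cls (SORL.rep hk (A + δ • Matrix.vecMulVec l l) Vδ σδ) -
                δ * SORL.mainCoeff hk cls (SORL.rep hk A V σ) l V σ W|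
              ≤ C * ((SORL.spectralGap σ k)⁻¹.toReal + δ ^ 2) := by
  obtain ⟨g, hg⟩ : ∃ g, g = a * (1 - 1 / G₀) := ⟨_, rfl⟩
  have hg0 : 0 < g := hg ▸ mul_pos ha (sub_pos.2 ((div_lt_one (one_pos.trans hG₀)).2 hG₀))
  obtain ⟨E, hE⟩ : ∃ E, E = 2 * k * (8 + 4 * (6 / g)) := ⟨_, rfl⟩
  have hE0 : 0 ≤ E := hE ▸ by positivity
  refine ⟨4 * k * B ^ 3 * E ^ 2 + 2 * k * B ^ 2 * (6 * k) * (2 + (21 + 8 * (6 / g) + (6 / g) ^ 2))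
    + 1, min (g / 6) (1 / (2 * B * (E + 1))), by positivity, by positivity, ?_⟩
  intro N hk A l cls V σ W h0 hdeg hl hV hW hak hgap hinter heta
  refine ⟨fun _ _ => SORL.upsilon_pos_of_mem_part hinter,
    fun _ _ h hintra => SORL.upsilon_neg_of_notMem_part hinter hintra h,
    fun δ hδ0 hδ Vδ σδ hVδ => ?_⟩
  obtain ⟨U, rfl, -⟩ := hV.exists_unitary
  obtain ⟨Uδ, rfl, -⟩ := hVδ.exists_unitary
  have hgap' := SORL.hasGap_range_castLE hk hV.antitone hV.nonneg ha hak hG₀ hgap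
  rw [← hg] at hgap'
  have hδg : 6 * δ ≤ g := by linarith [hδ.trans (min_le_left _ _)]
  have hδB := SORL.mul_mul_le_one hB hE0 hδ0 (hδ.trans (min_le_right _ _))
  have hb := SORL.singVal_succ_le_toReal_inv_spectralGap hV.nonneg
    (SORL.apply_le_one hdeg hV h0) (ha.trans_le hak)
  have herror := SORL.abs_kms_sub_kms_sub_mul_mainCoeff_le hdeg hV h0 hl hδ0 hVδ hgap' hδg hinter
    heta (hE ▸ hδB) hW
  refine ⟨SORL.inter_rep_pos hdeg hV h0 hl hδ0 hVδ hgap' hδg hinter heta (hE ▸ hδB),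
    herror.trans ?_⟩
  rw [← hE, mul_pow, ← mul_assoc (4 * k * B ^ 3), ← mul_assoc (2 * k * B ^ 2)]
  exact SORL.mul_sq_add_mul_le (by positivity) (by positivity) (by positivity) hgap'.nonneg hb

theorem mainTheorem5 (k : ℕ) (a G₀ B : ℝ) (ha : 0 < a) (hG₀ : 1 < G₀) (hB : 0 < B) :
    ∃ C δ₀ : ℝ, 0 < C ∧ 0 < δ₀ ∧
      ∀ (N : ℕ) (hk : k ≤ N) (Xbar : Type*) [MeasurableSpace Xbar]
        (P Pl : Measure Xbar) [IsProbabilityMeasure P] [IsProbabilityMeasure Pl]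
        (T : Kernel Xbar (Fin N)) [IsMarkovKernel T] (ηu : ℝ)
        (cls : Finpartition (Finset.univ : Finset (Fin N)))
        (V : Matrix (Fin N) (Fin N) ℝ) (σ : Fin N → ℝ) (W : Matrix (Fin N) (Fin (N - k)) ℝ)
        (Z : Matrix (Fin N) (Fin k) ℝ),
        (∀ x, SORL.degree (SORL.adj ηu P Pl T 0) x = 1) →
        SORL.IsSVD (SORL.normAdj (SORL.adj ηu P Pl T 0)) V σ →
        SORL.IsNullBasis (SORL.topVec hk V) W →
        Z = SORL.rep hk (SORL.adj ηu P Pl T 0) V σ →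
        a ≤ SORL.singVal σ k →
        ENNReal.ofReal G₀ ≤ SORL.spectralGap σ k →
        0 < SORL.inter cls Z →
        SORL.eta1 cls Z ≤ B →
        (∀ x x', x ≠ x' → x' ∈ cls.part x → 0 < SORL.upsilon cls Z x x') ∧
        (∀ x x', x' ∉ cls.part x → 0 < SORL.intra cls Z → SORL.upsilon cls Z x x' < 0) ∧
        ∀ δ : ℝ, 0 < δ → δ ≤ δ₀ →
          ∀ (Vδ : Matrix (Fin N) (Fin N) ℝ) (σδ : Fin N → ℝ),
            SORL.IsSVD (SORL.normAdj (SORL.adj ηu P Pl T δ)) Vδ σδ →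
            0 < SORL.inter cls (SORL.rep hk (SORL.adj ηu P Pl T δ) Vδ σδ) ∧
            |(SORL.kms cls Z - SORL.kms cls (SORL.rep hk (SORL.adj ηu P Pl T δ) Vδ σδ))
                - δ * SORL.mainCoeff hk cls Z (SORL.labelVec Pl T) V σ W|
              ≤ C * ((SORL.spectralGap σ k)⁻¹.toReal + δ ^ 2) := by
  obtain ⟨C, δ₀, hC, hδ₀, h⟩ := mainTheorem5_general k a G₀ B ha hG₀ hB
  refine ⟨C, δ₀, hC, hδ₀, fun N hk _ _ P Pl _ _ T _ ηu cls V σ W Z hdeg hV hW hZ hak hgap hinter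
    heta => ?_⟩
  subst hZ
  obtain ⟨hpos, hneg, hexp⟩ := h N hk _ (SORL.labelVec Pl T) cls V σ W
    (SORL.adj_zero_nonneg hdeg) hdeg SORL.labelVec_mem_stdSimplex hV hW hak hgap hinter heta
  exact ⟨hpos, hneg, fun δ hδ => by simpa only [← SORL.adj_eq] using hexp δ hδ.le⟩
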